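/- **Nets.** A *marked net* $N=(P,T,Fl,M_{init})$ has finite disjoint sets $P$ of places and $T$ of transitions, a flow relation $Fl\subseteq (T\times P)\cup(P\times T)$ and an initial marking $M_{init}\subseteq P$, such that every place has an input or an output transition and every transition has a pre-place. Write ${}^\bullet x$ and $x^\bullet$ for the sets of predecessors and successors of $x$ under $Fl$. A transition $t$ is fireable at a marking $M\subseteq P$ if ${}^\bullet t\subseteq M$, and firing it leads to $(M\setminus{}^\bullet t)\cup t^\bullet$. $N$ is *safe* if $t^\bullet\cap(M\setminus{}^\bullet t)=\emptyset$ whenever $M$ is reachable from $M_{init}$ and $t$ is fireable at $M$. The *reachability graph* of $N$ has the reachable markings as nodes, the firings $(M,t,M')$ as labelled arcs, and $M_{init}$ as initial node; isomorphisms preserve the initial node and the labelled arcs in both directions. A place is written $\pi_Z$, where $Z$ is a set of tagged transitions $t^{in}$, $t^{out}$: there is an arc from $t$ to $\pi_Z$ iff $t^{in}\in Z$, and an arc from $\pi_Z$ to $t$ iff $t^{out}\in Z$. For sets of places let $Q\otimes R=\{\pi_{Z\cup Z'}\mid \pi_Z\in Q,\ \pi_{Z'}\in R\}$. **Boxes.**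 Let $E$ be a box expression generated from the nonterminal $E$ of the grammar $$E::=a\mid E;E\mid E\,\square\,E\mid\langle E*H*E\rangle\mid E\,\|\,E,\qquad H::=a\mid E;E\mid H\,\square\,H\mid\langle E*H*E\rangle,$$ in which no action $a$ occurs more than once. Define sets $(\Pi^e,\Pi^x,\Pi^i)$ of entry, exit and internal places by - $\Pi_a=(\{\pi_{\{a^{out}\}}\},\{\pi_{\{a^{in}\}}\},\emptyset)$; - $\Pi_{E\|F}=(\Pi_E^e\cup\Pi_F^e,\ \Pi_E^x\cup\Pi_F^x,\ \Pi_E^i\cup\Pi_F^i)$; - $\Pi_{E;F}=(\Pi_E^e,\ \Pi_F^x,\ \Pi_E^i\cup\Pi_F^i\cup(\Pi_E^x\otimes\Pi_F^e))$; - $\Pi_{E\square F}=(\Pi_E^e\otimes\Pi_F^e,\ \Pi_E^x\otimes\Pi_F^x,\ \Pi_E^i\cup\Pi_F^i)$; - $\Pi_{\langle E*F*G\rangle}=(\Pi_E^e,\ \Pi_G^x,\ \Pi_E^i\cup\Pi_F^i\cup\Pi_G^i\cup((\Pi_E^x\otimes\Pi_F^x)\otimes(\Pi_G^e\otimes\Pi_F^e)))$.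 $BOX(E)$ is the net with places $\Pi_E^e\cup\Pi_E^x\cup\Pi_E^i$, the actions of $E$ as transitions, and initial marking $\Pi_E^e$. **Connection graph.** Define undirected graphs $(\Gamma_E^e,\Gamma_E^x,\Gamma_E^i)$ on tagged actions by the same clauses, with $\pi_{\{a^{out}\}}$ and $\pi_{\{a^{in}\}}$ replaced by the one-vertex graphs $a^{out}$ and $a^{in}$, $\cup$ by disjoint union, and $\otimes$ by graph join (disjoint union plus all edges between the two parts). The connection graph $CG_E$ is the disjoint union of $\Gamma_E^e$, $\Gamma_E^x$ and $\Gamma_E^i$. An *edge clique cover* of $CG_E$ is a set $\mathcal C$ of (inclusion-)maximal cliques of $CG_E$ such that every edge has both endpoints in some member of $\mathcal C$ and every isolated vertex belongs to some member of $\mathcal C$. A *partial* edge clique cover is defined in the same way, except that the edges between two vertices of the forms $a^{in}$ and $b^{in}$ need not be covered. Let $N_{\mathcal C}$ be the net with places $\{\pi_Z\mid Z\in\mathcal C\}$, with the actions occurring (tagged) in members of $\mathcal C$ as transitions, and with initial marking $\{p\mid{}^\bullet p=\emptyset\}$. Let $N'_{\mathcal C}$ be obtained from $N_{\mathcal C}$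 by deleting all the places $p$ with $p^\bullet=\emptyset$. **Theorem.** For every edge clique cover $\mathcal C$ of $CG_E$, $N_{\mathcal C}$ is a safe marked net whose reachability graph is isomorphic to that of $BOX(E)$. The same holds for $N'_{\mathcal C}$, and both claims also hold for every partial edge clique cover $\mathcal C$ of $CG_E$. -/

import Mathlib

/-! ## Marked nets -/

/-- The data `(P, T, Fl, M_init)` of a marked net with places in `π` and transitions in `τ`.
The flow relation is split into the arcs `arcTP` (transition to place) and `arcPT` (place to
transition); the axioms of a marked net are collected in `PetriNet.IsMarkedNet`. -/
structure PetriNet (π τ : Type*) where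
  places : Set π
  trans : Set τ
  arcTP : τ → π → Prop
  arcPT : π → τ → Prop
  init : Set π

namespace PetriNet

variable {π π' τ : Type*}

/-- Pre-places of a transition. -/
def pre (N : PetriNet π τ) (t : τ) : Set π := {p | N.arcPT p t}

/-- Post-places of a transition. -/
def post (N : PetriNet π τ) (t : τ) : Set π := {p | N.arcTP t p}

/-- Input transitions of a place. -/
def inputs (N : PetriNet π τ) (p : π) : Set τ := {t | N.arcTP t p}

/-- Output transitions of a place. -/
def outputs (N : PetriNet π τ) (p : π) : Set τ := {t | N.arcPT p t}

/-- Finitely many places and transitions, the flow relation is contained in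
`(T × P) ∪ (P × T)`, the initial marking is a set of places, every place has an input or an
output transition, and every transition has a pre-place. -/
structure IsMarkedNet (N : PetriNet π τ) : Prop where
  finite_places : N.places.Finite
  finite_trans : N.trans.Finite
  arcTP_mem : ∀ t p, N.arcTP t p → t ∈ N.trans ∧ p ∈ N.places
  arcPT_mem : ∀ p t, N.arcPT p t → p ∈ N.places ∧ t ∈ N.trans
  init_subset : N.init ⊆ N.places
  place_connected : ∀ p ∈ N.places, (N.inputs p).Nonempty ∨ (N.outputs p).Nonempty
  pre_nonempty : ∀ t ∈ N.trans, (N.pre t).Nonempty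

/-- `t` is fireable at the marking `M`. -/
def Fireable (N : PetriNet π τ) (M : Set π) (t : τ) : Prop :=
  t ∈ N.trans ∧ N.pre t ⊆ M

/-- Firing `t` at `M` leads to `M'`. -/
def Step (N : PetriNet π τ) (M : Set π) (t : τ) (M' : Set π) : Prop :=
  N.Fireable M t ∧ M' = (M \ N.pre t) ∪ N.post t

/-- The set of reachable markings. -/
def reach (N : PetriNet π τ) : Set (Set π) :=
  {M | Relation.ReflTransGen (fun M₁ M₂ => ∃ t, N.Step M₁ t M₂) N.init M}

theorem init_mem_reach (N : PetriNet π τ) : N.init ∈ N.reach :=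
  Relation.ReflTransGen.refl

/-- Safeness: no fireable transition puts a token on a place that keeps a token. -/
def Safe (N : PetriNet π τ) : Prop :=
  ∀ M ∈ N.reach, ∀ t, N.Fireable M t → N.post t ∩ (M \ N.pre t) = ∅

/-- Isomorphism of reachability graphs: a bijection between the reachable markings that
preserves the initial node and preserves and reflects the arcs labelled by transitions. -/
def RGIso (N : PetriNet π τ) (N' : PetriNet π' τ) : Prop :=
  ∃ ι : N.reach ≃ N'.reach,
    ι ⟨N.init, N.init_mem_reach⟩ = ⟨N'.init, N'.init_mem_reach⟩ ∧
      ∀ (M M' : N.reach) (t : τ),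
        N.Step (M : Set π) t (M' : Set π) ↔
          N'.Step (ι M : Set π') t (ι M' : Set π')

/-- Deletion of all the places without output transitions (transitions are kept). -/
def deleteSinks (N : PetriNet π τ) : PetriNet π τ where
  places := {p ∈ N.places | (N.outputs p).Nonempty}
  trans := N.trans
  arcTP t p := N.arcTP t p ∧ (N.outputs p).Nonempty
  arcPT p t := N.arcPT p t ∧ (N.outputs p).Nonempty
  init := {p ∈ N.init | (N.outputs p).Nonempty}

end PetriNet

/-! ## Box expressions -/

/-- Box expressions over the actions `α`; `iter E F G` starts with `E`, repeats `F` any number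
of times, and ends with `G`. -/
inductive BoxExpr (α : Type*) where
  | act (a : α)
  | seq (E F : BoxExpr α)
  | choice (E F : BoxExpr α)
  | par (E F : BoxExpr α)
  | iter (E F G : BoxExpr α)

/-- The two nonterminals of the safe syntax. -/
inductive NonTerm where
  | E
  | H

/-- The safe syntax:
`E ::= a | E;E | E[]E | <E*H*E> | E||E` and `H ::= a | E;E | H[]H | <E*H*E>`. -/
inductive Derives {α : Type*} : NonTerm → BoxExpr α → Prop
  | actE (a : α) : Derives .E (.act a)
  | seqE {A B : BoxExpr α} : Derives .E A → Derives .E B → Derives .E (.seq A B)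
  | choiceE {A B : BoxExpr α} : Derives .E A → Derives .E B → Derives .E (.choice A B)
  | iterE {A B C : BoxExpr α} :
      Derives .E A → Derives .H B → Derives .E C → Derives .E (.iter A B C)
  | parE {A B : BoxExpr α} : Derives .E A → Derives .E B → Derives .E (.par A B)
  | actH (a : α) : Derives .H (.act a)
  | seqH {A B : BoxExpr α} : Derives .E A → Derives .E B → Derives .H (.seq A B)
  | choiceH {A B : BoxExpr α} : Derives .H A → Derives .H B → Derives .H (.choice A B)
  | iterH {A B C : BoxExpr α} :
      Derives .E A → Derives .H B → Derives .E C → Derives .H (.iter A B C)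

/-- Tagged actions `a^in` and `a^out`. -/
inductive Tagged (α : Type*) where
  | inp (a : α)
  | out (a : α)

/-- A place `π_Z` is identified with the set `Z` of its tagged transitions: `t^in ∈ Z` means that
`t` is an input transition, and `t^out ∈ Z` that `t` is an output transition. -/
abbrev Place (α : Type*) := Set (Tagged α)

/-- The net with places `P`, transitions `T`, initial marking `M`, and the arcs implied by the
names of the places. -/
def netOfPlaces {α : Type*} (P : Set (Place α)) (T : Set α) (M : Set (Place α)) :
    PetriNet (Place α) α where
  places := P
  trans := T
  arcTP t Z := t ∈ T ∧ Z ∈ P ∧ Tagged.inp t ∈ Z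
  arcPT Z t := Z ∈ P ∧ t ∈ T ∧ Tagged.out t ∈ Z
  init := M

/-- The cross-product of two sets of places. -/
def crossProd {α : Type*} (Q R : Set (Place α)) : Set (Place α) :=
  Set.image2 (fun Z Z' => Z ∪ Z') Q R

namespace BoxExpr

variable {α : Type*}

/-- The list of occurrences of actions. -/
def actions : BoxExpr α → List α
  | act a => [a]
  | seq E F => E.actions ++ F.actions
  | choice E F => E.actions ++ F.actions
  | par E F => E.actions ++ F.actions
  | iter E F G => E.actions ++ F.actions ++ G.actions

/-- Entry places. -/
def entry : BoxExpr α → Set (Place α)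
  | act a => {{Tagged.out a}}
  | seq E _ => E.entry
  | choice E F => crossProd E.entry F.entry
  | par E F => E.entry ∪ F.entry
  | iter E _ _ => E.entry

/-- Exit places. -/
def exit : BoxExpr α → Set (Place α)
  | act a => {{Tagged.inp a}}
  | seq _ F => F.exit
  | choice E F => crossProd E.exit F.exit
  | par E F => E.exit ∪ F.exit
  | iter _ _ G => G.exit

/-- Internal places. -/
def internal : BoxExpr α → Set (Place α)
  | act _ => ∅
  | seq E F => E.internal ∪ F.internal ∪ crossProd E.exit F.entry
  | choice E F => E.internal ∪ F.internal
  | par E F => E.internal ∪ F.internal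
  | iter E F G => E.internal ∪ F.internal ∪ G.internal ∪
      crossProd (crossProd E.exit F.exit) (crossProd G.entry F.entry)

/-- The marked net `BOX(E)`. -/
def box (E : BoxExpr α) : PetriNet (Place α) α :=
  netOfPlaces (E.entry ∪ E.exit ∪ E.internal) {a | a ∈ E.actions} E.entry

end BoxExpr

/-! ## Connection graphs -/

/-- Undirected loopless graphs whose vertex set is a set of tagged actions. -/
abbrev ConnGraph (α : Type*) := (⊤ : SimpleGraph (Tagged α)).Subgraph

namespace ConnGraph

variable {α : Type*}

/-- The graph with the single vertex `v`. -/
def single (v : Tagged α) : ConnGraph α := SimpleGraph.singletonSubgraph _ v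

/-- The join of two graphs (meant for disjoint vertex sets, where `v ≠ w` holds automatically):
their union together with all the edges between a vertex of `G` and a vertex of `G'`. -/
def join (G G' : ConnGraph α) : ConnGraph α where
  verts := G.verts ∪ G'.verts
  Adj v w := G.Adj v w ∨ G'.Adj v w ∨
    (v ≠ w ∧ ((v ∈ G.verts ∧ w ∈ G'.verts) ∨ (v ∈ G'.verts ∧ w ∈ G.verts)))
  adj_sub := by
    rintro v w (h | h | h)
    · exact G.adj_sub h
    · exact G'.adj_sub h
    · exact h.1
  edge_vert := by
    rintro v w (h | h | ⟨_, h | h⟩)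
    · exact Or.inl (G.edge_vert h)
    · exact Or.inr (G'.edge_vert h)
    · exact Or.inl h.1
    · exact Or.inr h.1
  symm := ⟨by
    rintro v w (h | h | ⟨hne, h | h⟩)
    · exact Or.inl h.symm
    · exact Or.inr (Or.inl h.symm)
    · exact Or.inr (Or.inr ⟨hne.symm, Or.inr ⟨h.2, h.1⟩⟩)
    · exact Or.inr (Or.inr ⟨hne.symm, Or.inl ⟨h.2, h.1⟩⟩)⟩

/-- A clique: a non-empty set of pairwise adjacent vertices. -/
def IsClique (G : ConnGraph α) (K : Set (Tagged α)) : Prop :=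
  K.Nonempty ∧ K ⊆ G.verts ∧ K.Pairwise G.Adj

/-- The maximal cliques. -/
def maxCliques (G : ConnGraph α) : Set (Set (Tagged α)) :=
  {K | Maximal G.IsClique K}

/-- `C` is a set of maximal cliques of `G` that covers every edge except possibly those
in `D` (regarded as covered already), and every isolated vertex. -/
structure IsPartialEdgeCliqueCover (G : ConnGraph α) (D : Tagged α → Tagged α → Prop)
    (C : Set (Set (Tagged α))) : Prop where
  subset_maxCliques : C ⊆ G.maxCliques
  covers_edge : ∀ v w, G.Adj v w → ¬ D v w → ∃ K ∈ C, v ∈ K ∧ w ∈ K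
  covers_isolated : ∀ v ∈ G.verts, (∀ w, ¬ G.Adj v w) → ∃ K ∈ C, v ∈ K

/-- An edge clique cover by maximal cliques: no edge is regarded as covered already. -/
def IsEdgeCliqueCover (G : ConnGraph α) (C : Set (Set (Tagged α))) : Prop :=
  G.IsPartialEdgeCliqueCover (fun _ _ => False) C

/-- The pairs of vertices both of which have the form `a^in`. -/
def InIn (v w : Tagged α) : Prop := (∃ a, v = Tagged.inp a) ∧ ∃ b, w = Tagged.inp b

end ConnGraph

namespace BoxExpr

variable {α : Type*}

/-- The graph of the entry places. -/
def entryGraph : BoxExpr α → ConnGraph α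
  | act a => ConnGraph.single (Tagged.out a)
  | seq E _ => E.entryGraph
  | choice E F => ConnGraph.join E.entryGraph F.entryGraph
  | par E F => E.entryGraph ⊔ F.entryGraph
  | iter E _ _ => E.entryGraph

/-- The graph of the exit places. -/
def exitGraph : BoxExpr α → ConnGraph α
  | act a => ConnGraph.single (Tagged.inp a)
  | seq _ F => F.exitGraph
  | choice E F => ConnGraph.join E.exitGraph F.exitGraph
  | par E F => E.exitGraph ⊔ F.exitGraph
  | iter _ _ G => G.exitGraph

/-- The graph of the internal places. -/
def internalGraph : BoxExpr α → ConnGraph α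
  | act _ => ⊥
  | seq E F => E.internalGraph ⊔ F.internalGraph ⊔ ConnGraph.join E.exitGraph F.entryGraph
  | choice E F => E.internalGraph ⊔ F.internalGraph
  | par E F => E.internalGraph ⊔ F.internalGraph
  | iter E F G => E.internalGraph ⊔ F.internalGraph ⊔ G.internalGraph ⊔
      ConnGraph.join (ConnGraph.join E.exitGraph F.exitGraph)
        (ConnGraph.join F.entryGraph G.entryGraph)

/-- The connection graph `CG_E`. The three parts, and all the graphs united or joined above, have
disjoint vertex sets when no action occurs twice, so `⊔` is their disjoint union. -/
def connGraph (E : BoxExpr α) : ConnGraph α :=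
  E.entryGraph ⊔ E.exitGraph ⊔ E.internalGraph

end BoxExpr

/-- The net `N_C`: its places are the cliques in `C`, its transitions are the actions that occur
in them, and the initially marked places are those without input transitions. -/
def cliqueNet {α : Type*} (C : Set (Set (Tagged α))) : PetriNet (Place α) α :=
  netOfPlaces C
    ({t | ∃ Z ∈ C, Tagged.inp t ∈ Z} ∪ {t | ∃ Z ∈ C, Tagged.out t ∈ Z})
    {Z ∈ C | ∀ t, Tagged.inp t ∉ Z}

/-!
The maximal cliques of a join are the unions of maximal cliques of its two parts, so the maximal
cliques of `CG_E` are exactly the places of `BOX(E)`, and `N_C` is the restriction of `BOX(E)` to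
some of its places. The cover still shows, for every action `t`, which tagged actions share a place
with `t^out`.

The key property of `BOX(E)` is soundness: it is safe, it can always run to its final marking, and a
place is marked as soon as each of its tagged actions lies in a marked place. By the last property
`M ↦ M ∩ C` reflects fireability. This map is injective on the reachable markings: run two markings
with the same image in parallel until one of them is final; then so is the other one, and by
safeness firings can be undone. The same argument applies to `N'_C`, since sinks never restrict
fireability.

Soundness is proved by induction on `E`. Sequence, choice and iteration all glue boxes along the
nodes of a directed graph, and every reachable marking of the glued net comes from a reachable
marking of a single box. In a loop this requires that the body never marks an entry place and an
exit place simultaneously, which is what the grammar of `H` guarantees.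
-/

/-! ## Maximal cliques of joins and disjoint unions -/

namespace ConnGraph

variable {α : Type*} {G H : ConnGraph α} {K A B : Set (Tagged α)}

theorem IsClique.mono (hGH : G ≤ H) (hK : G.IsClique K) : H.IsClique K :=
  ⟨hK.1, hK.2.1.trans hGH.1, hK.2.2.mono' fun _ _ h => hGH.2 h⟩

theorem isClique_singleton {v : Tagged α} (hv : v ∈ G.verts) : G.IsClique {v} :=
  ⟨Set.singleton_nonempty v, Set.singleton_subset_iff.2 hv, Set.pairwise_singleton _ _⟩

theorem isClique_sup_iff (hd : Disjoint G.verts H.verts) :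
    (G ⊔ H).IsClique K ↔ G.IsClique K ∨ H.IsClique K := by
  refine ⟨fun hK => ?_, fun hK => hK.elim (.mono le_sup_left) (.mono le_sup_right)⟩
  have restrict {G H : ConnGraph α} (hd : Disjoint G.verts H.verts) (hK : (G ⊔ H).IsClique K)
      {v : Tagged α} (hvK : v ∈ K) (hvG : v ∈ G.verts) : G.IsClique K := by
    have adj_of_mem {u w : Tagged α} (hu : u ∈ G.verts) (huw : (G ⊔ H).Adj u w) : G.Adj u w :=
      huw.resolve_right fun h => hd.notMem_of_mem_left hu (H.edge_vert h)
    have hKG : K ⊆ G.verts := fun w hw => by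
      by_cases hvw : v = w
      · exact hvw ▸ hvG
      · exact G.edge_vert (adj_of_mem hvG (hK.2.2 hvK hw hvw)).symm
    exact ⟨hK.1, hKG, fun u hu w hw huw => adj_of_mem (hKG hu) (hK.2.2 hu hw huw)⟩
  obtain ⟨v, hv⟩ := hK.1
  rcases hK.2.1 hv with hvG | hvH
  · exact .inl (restrict hd hK hv hvG)
  · exact .inr (restrict hd.symm (sup_comm G H ▸ hK) hv hvH)

theorem maxCliques_sup (hd : Disjoint G.verts H.verts) :
    (G ⊔ H).maxCliques = G.maxCliques ∪ H.maxCliques := by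
  have incomparable {G H : ConnGraph α} {K L : Set (Tagged α)} (hd : Disjoint G.verts H.verts)
      (hK : G.IsClique K) (hL : H.IsClique L) : ¬ K ⊆ L := fun hKL =>
    hK.1.not_subset_empty (hd.mono hK.2.1 hL.2.1 le_rfl hKL)
  ext K
  simp only [maxCliques, Set.mem_ofPred_eq, Set.mem_union, Maximal, isClique_sup_iff hd]
  constructor
  · rintro ⟨hK | hK, hmax⟩
    · exact .inl ⟨hK, fun L hL => hmax (.inl hL)⟩
    · exact .inr ⟨hK, fun L hL => hmax (.inr hL)⟩
  · rintro (⟨hK, hmax⟩ | ⟨hK, hmax⟩)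
    · exact ⟨.inl hK, fun L hL hKL =>
        hL.elim (hmax · hKL) fun hL => (incomparable hd hK hL hKL).elim⟩
    · exact ⟨.inr hK, fun L hL hKL =>
        hL.elim (fun hL => (incomparable hd.symm hK hL hKL).elim) (hmax · hKL)⟩

theorem join_comm (G H : ConnGraph α) : G.join H = H.join G := by
  ext v w
  · exact or_comm
  · simp only [join]
    tauto

theorem IsClique.union_join (hA : G.IsClique A) (hB : H.IsClique B) :
    (G.join H).IsClique (A ∪ B) := by
  refine ⟨hA.1.inl, Set.union_subset_union hA.2.1 hB.2.1, ?_⟩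
  rintro v (hv | hv) w (hw | hw) hvw
  · exact .inl (hA.2.2 hv hw hvw)
  · exact .inr (.inr ⟨hvw, .inl ⟨hA.2.1 hv, hB.2.1 hw⟩⟩)
  · exact .inr (.inr ⟨hvw, .inr ⟨hB.2.1 hv, hA.2.1 hw⟩⟩)
  · exact .inr (.inl (hB.2.2 hv hw hvw))

theorem IsClique.inter_of_join (hd : Disjoint G.verts H.verts) (hK : (G.join H).IsClique K)
    (hne : (K ∩ G.verts).Nonempty) : G.IsClique (K ∩ G.verts) := by
  refine ⟨hne, Set.inter_subset_right, fun v hv w hw hvw => ?_⟩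
  rcases hK.2.2 hv.1 hw.1 hvw with h | h | ⟨-, h | h⟩
  · exact h
  · exact (hd.notMem_of_mem_left hv.2 (H.edge_vert h)).elim
  · exact (hd.notMem_of_mem_left hw.2 h.2).elim
  · exact (hd.notMem_of_mem_left hv.2 h.1).elim

theorem IsClique.inter_union_inter_of_join (hK : (G.join H).IsClique K) :
    K ∩ G.verts ∪ K ∩ H.verts = K := by
  rw [← Set.inter_union_distrib_left]
  exact Set.inter_eq_left.2 hK.2.1

theorem inter_nonempty_of_mem_maxCliques_join (hd : Disjoint G.verts H.verts)
    (hG : G.verts.Nonempty) (hK : K ∈ (G.join H).maxCliques) : (K ∩ G.verts).Nonempty := by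
  by_contra hne
  have hKH : K ∩ H.verts = K := by
    simpa [Set.not_nonempty_iff_eq_empty.1 hne] using hK.1.inter_union_inter_of_join
  have hclique : H.IsClique K := by
    have := IsClique.inter_of_join hd.symm (join_comm G H ▸ hK.1) (hKH.symm ▸ hK.1.1)
    rwa [hKH] at this
  obtain ⟨v, hv⟩ := hG
  have hvK := hK.2 ((isClique_singleton hv).union_join hclique) Set.subset_union_right
    (.inl (Set.mem_singleton v))
  exact hne ⟨v, hvK, hv⟩

theorem inter_mem_maxCliques_of_join (hd : Disjoint G.verts H.verts) (hG : G.verts.Nonempty)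
    (hH : H.verts.Nonempty) (hK : K ∈ (G.join H).maxCliques) :
    K ∩ G.verts ∈ G.maxCliques := by
  have hKH : H.IsClique (K ∩ H.verts) := .inter_of_join hd.symm (join_comm G H ▸ hK.1)
    (inter_nonempty_of_mem_maxCliques_join hd.symm hH (join_comm G H ▸ hK))
  refine ⟨.inter_of_join hd hK.1 (inter_nonempty_of_mem_maxCliques_join hd hG hK),
    fun A hA hKA => ?_⟩
  have hKle : K ⊆ A ∪ K ∩ H.verts := by
    rw [← hK.1.inter_union_inter_of_join, Set.union_inter_distrib_right]
    grind
  exact fun v hv => ⟨hK.2 (hA.union_join hKH) hKle (.inl hv), hA.2.1 hv⟩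

theorem union_mem_maxCliques_join (hd : Disjoint G.verts H.verts) (hA : A ∈ G.maxCliques)
    (hB : B ∈ H.maxCliques) : A ∪ B ∈ (G.join H).maxCliques := by
  refine ⟨hA.1.union_join hB.1, fun K hK hle => ?_⟩
  have hAK : A ⊆ K ∩ G.verts := Set.subset_inter (Set.subset_union_left.trans hle) hA.1.2.1
  have hBK : B ⊆ K ∩ H.verts := Set.subset_inter (Set.subset_union_right.trans hle) hB.1.2.1
  rw [← hK.inter_union_inter_of_join]
  exact Set.union_subset_union (hA.2 (hK.inter_of_join hd (hA.1.1.mono hAK)) hAK)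
    (hB.2 (.inter_of_join hd.symm (join_comm G H ▸ hK) (hB.1.1.mono hBK)) hBK)

theorem maxCliques_join (hd : Disjoint G.verts H.verts) (hG : G.verts.Nonempty)
    (hH : H.verts.Nonempty) :
    (G.join H).maxCliques = crossProd G.maxCliques H.maxCliques := by
  ext K
  constructor
  · intro hK
    exact ⟨K ∩ G.verts, inter_mem_maxCliques_of_join hd hG hH hK, K ∩ H.verts,
      inter_mem_maxCliques_of_join hd.symm hH hG (join_comm G H ▸ hK),
      hK.1.inter_union_inter_of_join⟩
  · rintro ⟨A, hA, B, hB, rfl⟩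
    exact union_mem_maxCliques_join hd hA hB

theorem maxCliques_bot : (⊥ : ConnGraph α).maxCliques = ∅ :=
  Set.eq_empty_of_forall_notMem fun _ hK => (hK.1.1.mono hK.1.2.1).ne_empty rfl

theorem maxCliques_single (v : Tagged α) : (single v).maxCliques = {{v}} := by
  have isClique_iff (K : Set (Tagged α)) : (single v).IsClique K ↔ K = {v} := by
    refine ⟨fun hK => hK.1.subset_singleton_iff.1 hK.2.1, ?_⟩
    rintro rfl
    exact isClique_singleton rfl
  ext K
  simp only [maxCliques, Set.mem_ofPred_eq, Maximal, isClique_iff, Set.mem_singleton_iff]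
  grind

end ConnGraph

/-! ## Maximal cliques of the connection graph -/

/-- The action `a` underlying the tagged actions `a^in` and `a^out`. -/
def Tagged.action {α : Type*} : Tagged α → α
  | inp a => a
  | out a => a

section CrossProd

variable {α : Type*} {Q R : Set (Place α)}

theorem sUnion_crossProd (hQ : Q.Nonempty) (hR : R.Nonempty) :
    ⋃₀ crossProd Q R = ⋃₀ Q ∪ ⋃₀ R := by
  ext v
  simp only [crossProd, Set.mem_sUnion, Set.mem_image2, Set.mem_union]
  constructor
  · rintro ⟨_, ⟨Z, hZ, W, hW, rfl⟩, hv | hv⟩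
    · exact .inl ⟨Z, hZ, hv⟩
    · exact .inr ⟨W, hW, hv⟩
  · obtain ⟨Z₀, hZ₀⟩ := hQ
    obtain ⟨W₀, hW₀⟩ := hR
    rintro (⟨Z, hZ, hv⟩ | ⟨W, hW, hv⟩)
    · exact ⟨Z ∪ W₀, ⟨Z, hZ, W₀, hW₀, rfl⟩, .inl hv⟩
    · exact ⟨Z₀ ∪ W, ⟨Z₀, hZ₀, W, hW, rfl⟩, .inr hv⟩

theorem crossProd_nonempty (hQ : Q.Nonempty) (hR : R.Nonempty) : (crossProd Q R).Nonempty :=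
  hQ.image2 hR

theorem crossProd_comm (Q R : Set (Place α)) : crossProd Q R = crossProd R Q :=
  Set.image2_comm fun Z W => Set.union_comm Z W

end CrossProd

namespace BoxExpr

variable {α : Type*} (E : BoxExpr α)

/-- All the places of `BOX(E)`. -/
def places : Set (Place α) := E.entry ∪ E.exit ∪ E.internal

theorem entry_nonempty : E.entry.Nonempty := by
  induction E with
  | act a => exact Set.singleton_nonempty _
  | seq _ _ ihE _ => exact ihE
  | choice E F ihE ihF => exact ihE.image2 ihF
  | par E F ihE _ => exact ihE.inl
  | iter _ _ _ ihE _ _ => exact ihE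

theorem exit_nonempty : E.exit.Nonempty := by
  induction E with
  | act a => exact Set.singleton_nonempty _
  | seq _ _ _ ihF => exact ihF
  | choice E F ihE ihF => exact ihE.image2 ihF
  | par E F ihE _ => exact ihE.inl
  | iter _ _ _ _ _ ihG => exact ihG

theorem sUnion_entry_subset : ⋃₀ E.entry ⊆ Set.range Tagged.out := by
  induction E with
  | act a => simp [entry]
  | seq _ _ ihE _ => exact ihE
  | choice E F ihE ihF =>
    rw [entry, sUnion_crossProd E.entry_nonempty F.entry_nonempty]
    exact Set.union_subset ihE ihF
  | par E F ihE ihF =>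
    rw [entry, Set.sUnion_union]
    exact Set.union_subset ihE ihF
  | iter _ _ _ ihE _ _ => exact ihE

theorem sUnion_exit_subset : ⋃₀ E.exit ⊆ Set.range Tagged.inp := by
  induction E with
  | act a => simp [exit]
  | seq _ _ _ ihF => exact ihF
  | choice E F ihE ihF =>
    rw [exit, sUnion_crossProd E.exit_nonempty F.exit_nonempty]
    exact Set.union_subset ihE ihF
  | par E F ihE ihF =>
    rw [exit, Set.sUnion_union]
    exact Set.union_subset ihE ihF
  | iter _ _ _ _ _ ihG => exact ihG

theorem sUnion_places : ⋃₀ E.places = {v | v.action ∈ E.actions} := by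
  have sUnion_places_eq (E : BoxExpr α) :
      ⋃₀ E.places = ⋃₀ E.entry ∪ ⋃₀ E.exit ∪ ⋃₀ E.internal := by
    rw [places, Set.sUnion_union, Set.sUnion_union]
  induction E with
  | act a =>
    ext (b | b) <;> simp [places, entry, exit, internal, actions, Tagged.action]
  | seq E F ihE ihF | choice E F ihE ihF | par E F ihE ihF | iter E F G ihE ihF ihG =>
    simp only [sUnion_places_eq, Set.ext_iff, Set.mem_union, Set.mem_ofPred_eq, entry, exit,
      internal, actions, Set.sUnion_union, sUnion_crossProd, crossProd_nonempty, entry_nonempty,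
      exit_nonempty, List.mem_append] at *
    grind

theorem entry_subset_places : E.entry ⊆ E.places := fun _ hZ => .inl (.inl hZ)

theorem exit_subset_places : E.exit ⊆ E.places := fun _ hZ => .inl (.inr hZ)

theorem internal_subset_places : E.internal ⊆ E.places := fun _ hZ => .inr hZ

theorem exists_mem_places {v : Tagged α} (hv : v.action ∈ E.actions) : ∃ Z ∈ E.places, v ∈ Z :=
  (E.sUnion_places.symm ▸ hv : v ∈ ⋃₀ E.places)

variable {E}

theorem action_mem {Z : Place α} {v : Tagged α} (hZ : Z ∈ E.places) (hv : v ∈ Z) :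
    v.action ∈ E.actions :=
  (E.sUnion_places ▸ ⟨Z, hZ, hv⟩ : v ∈ {v | v.action ∈ E.actions})

theorem disjoint_sUnion_places {F : BoxExpr α} (h : E.actions.Disjoint F.actions) :
    Disjoint (⋃₀ E.places) (⋃₀ F.places) := by
  rw [sUnion_places, sUnion_places]
  exact Set.disjoint_left.2 fun v hE hF => h hE hF

theorem disjoint_sUnion_entry_exit (F : BoxExpr α) : Disjoint (⋃₀ E.entry) (⋃₀ F.exit) := by
  refine Set.disjoint_of_subset E.sUnion_entry_subset F.sUnion_exit_subset ?_
  exact Set.disjoint_left.2 fun _ ⟨a, ha⟩ ⟨b, hb⟩ => by cases ha.trans hb.symm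

theorem action_mem_of_mem_sUnion_entry {v : Tagged α} (hv : v ∈ ⋃₀ E.entry) :
    v.action ∈ E.actions := by
  obtain ⟨Z, hZ, hv⟩ := hv
  exact action_mem (.inl (.inl hZ)) hv

theorem action_mem_of_mem_sUnion_exit {v : Tagged α} (hv : v ∈ ⋃₀ E.exit) :
    v.action ∈ E.actions := by
  obtain ⟨Z, hZ, hv⟩ := hv
  exact action_mem (.inl (.inr hZ)) hv

theorem action_mem_of_mem_sUnion_internal {v : Tagged α} (hv : v ∈ ⋃₀ E.internal) :
    v.action ∈ E.actions := by
  obtain ⟨Z, hZ, hv⟩ := hv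
  exact action_mem (.inr hZ) hv

theorem disjoint_sUnion_internal (h : E.actions.Nodup) :
    Disjoint (⋃₀ E.entry ∪ ⋃₀ E.exit) (⋃₀ E.internal) := by
  have hentry {A B : BoxExpr α} := disjoint_sUnion_entry_exit (E := A) B
  induction E with
  | act a => simp [internal]
  | seq E F ihE ihF | choice E F ihE ihF | par E F ihE ihF | iter E F G ihE ihF ihG =>
    simp only [Set.disjoint_left, Set.mem_union, entry, exit, internal, actions, Set.sUnion_union,
      sUnion_crossProd, crossProd_nonempty, entry_nonempty, exit_nonempty,
      List.nodup_append', List.disjoint_left, List.mem_append] at *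
    grind [→ action_mem_of_mem_sUnion_entry, → action_mem_of_mem_sUnion_exit,
      → action_mem_of_mem_sUnion_internal]

theorem disjoint_sUnion {F : BoxExpr α} {Q R : Set (Place α)} (h : E.actions.Disjoint F.actions)
    (hQ : Q ⊆ E.places) (hR : R ⊆ F.places) : Disjoint (⋃₀ Q) (⋃₀ R) :=
  (disjoint_sUnion_places h).mono (Set.sUnion_mono hQ) (Set.sUnion_mono hR)

end BoxExpr

/-- The places in `Q` are the maximal cliques of `G`, and they contain all its vertices. -/
structure ConnGraph.Represents {α : Type*} (G : ConnGraph α) (Q : Set (Place α)) : Prop where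
  maxCliques_eq : G.maxCliques = Q
  verts_eq : G.verts = ⋃₀ Q

namespace ConnGraph.Represents

variable {α : Type*} {G H : ConnGraph α} {Q R : Set (Place α)}

theorem bot : (⊥ : ConnGraph α).Represents ∅ :=
  ⟨maxCliques_bot, Set.sUnion_empty.symm⟩

theorem single (v : Tagged α) : (ConnGraph.single v).Represents {{v}} :=
  ⟨maxCliques_single v, (Set.sUnion_singleton _).symm⟩

theorem verts_nonempty (hG : G.Represents Q) (hQ : Q.Nonempty) : G.verts.Nonempty := by
  obtain ⟨K, hK⟩ := hQ
  rw [← hG.maxCliques_eq] at hK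
  exact hK.1.1.mono hK.1.2.1

theorem sup (hG : G.Represents Q) (hH : H.Represents R) (hd : Disjoint (⋃₀ Q) (⋃₀ R)) :
    (G ⊔ H).Represents (Q ∪ R) where
  maxCliques_eq := by
    rw [maxCliques_sup (by rwa [hG.verts_eq, hH.verts_eq]), hG.maxCliques_eq, hH.maxCliques_eq]
  verts_eq := by
    rw [SimpleGraph.Subgraph.verts_sup, hG.verts_eq, hH.verts_eq, Set.sUnion_union]

theorem join (hG : G.Represents Q) (hH : H.Represents R) (hQ : Q.Nonempty) (hR : R.Nonempty)
    (hd : Disjoint (⋃₀ Q) (⋃₀ R)) : (G.join H).Represents (crossProd Q R) where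
  maxCliques_eq := by
    rw [maxCliques_join (by rwa [hG.verts_eq, hH.verts_eq]) (hG.verts_nonempty hQ)
      (hH.verts_nonempty hR), hG.maxCliques_eq, hH.maxCliques_eq]
  verts_eq := by
    rw [sUnion_crossProd hQ hR, ← hG.verts_eq, ← hH.verts_eq]
    rfl

end ConnGraph.Represents

namespace BoxExpr

variable {α : Type*} {E : BoxExpr α}

theorem entryGraph_represents (h : E.actions.Nodup) : E.entryGraph.Represents E.entry := by
  induction E with
  | act a => exact .single _
  | seq E F ihE _ => exact ihE h.of_append_left
  | choice E F ihE ihF =>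
    exact (ihE h.of_append_left).join (ihF h.of_append_right) E.entry_nonempty F.entry_nonempty <|
      disjoint_sUnion (List.disjoint_of_nodup_append h) E.entry_subset_places F.entry_subset_places
  | par E F ihE ihF =>
    exact (ihE h.of_append_left).sup (ihF h.of_append_right) <|
      disjoint_sUnion (List.disjoint_of_nodup_append h) E.entry_subset_places F.entry_subset_places
  | iter E F G ihE _ _ => exact ihE h.of_append_left.of_append_left

theorem exitGraph_represents (h : E.actions.Nodup) : E.exitGraph.Represents E.exit := by
  induction E with
  | act a => exact .single _
  | seq E F _ ihF => exact ihF h.of_append_right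
  | choice E F ihE ihF =>
    exact (ihE h.of_append_left).join (ihF h.of_append_right) E.exit_nonempty F.exit_nonempty <|
      disjoint_sUnion (List.disjoint_of_nodup_append h) E.exit_subset_places F.exit_subset_places
  | par E F ihE ihF =>
    exact (ihE h.of_append_left).sup (ihF h.of_append_right) <|
      disjoint_sUnion (List.disjoint_of_nodup_append h) E.exit_subset_places F.exit_subset_places
  | iter E F G _ _ ihG => exact ihG h.of_append_right

theorem internalGraph_represents (h : E.actions.Nodup) :
    E.internalGraph.Represents E.internal := by
  induction E with
  | act a => exact .bot
  | choice E F ihE ihF | par E F ihE ihF =>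
    exact (ihE h.of_append_left).sup (ihF h.of_append_right) <| disjoint_sUnion
      (List.disjoint_of_nodup_append h) E.internal_subset_places F.internal_subset_places
  | seq E F ihE ihF =>
    have hE := h.of_append_left
    have hF := h.of_append_right
    have hEF := List.disjoint_of_nodup_append h
    refine ((ihE hE).sup (ihF hF) ?_).sup
      ((exitGraph_represents hE).join (entryGraph_represents hF) E.exit_nonempty
        F.entry_nonempty (disjoint_sUnion_entry_exit E).symm) ?_
    · exact disjoint_sUnion hEF E.internal_subset_places F.internal_subset_places
    · have hdE := disjoint_sUnion_internal hE
      have hdF := disjoint_sUnion_internal hF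
      simp only [Set.disjoint_left, Set.mem_union, Set.sUnion_union, List.disjoint_left,
        sUnion_crossProd E.exit_nonempty F.entry_nonempty] at *
      grind [→ action_mem_of_mem_sUnion_entry, → action_mem_of_mem_sUnion_exit,
        → action_mem_of_mem_sUnion_internal]
  | iter E F G ihE ihF ihG =>
    have hE := h.of_append_left.of_append_left
    have hF := h.of_append_left.of_append_right
    have hG := h.of_append_right
    have hEF := List.disjoint_of_nodup_append h.of_append_left
    have hEFG := List.disjoint_of_nodup_append h
    rw [internal, crossProd_comm G.entry]
    refine (((ihE hE).sup (ihF hF) ?_).sup (ihG hG) ?_).sup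
      (((exitGraph_represents hE).join (exitGraph_represents hF) E.exit_nonempty
        F.exit_nonempty ?_).join ((entryGraph_represents hF).join (entryGraph_represents hG)
        F.entry_nonempty G.entry_nonempty ?_) (crossProd_nonempty E.exit_nonempty F.exit_nonempty)
          (crossProd_nonempty F.entry_nonempty G.entry_nonempty) ?_) ?_
    all_goals
      have hdE := disjoint_sUnion_internal hE
      have hdF := disjoint_sUnion_internal hF
      have hdG := disjoint_sUnion_internal hG
      have hentry {A B : BoxExpr α} := disjoint_sUnion_entry_exit (E := A) B
      simp only [Set.disjoint_left, Set.mem_union, Set.sUnion_union, List.disjoint_left,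
        sUnion_crossProd, crossProd_nonempty, entry_nonempty, exit_nonempty, List.mem_append] at *
      grind [→ action_mem_of_mem_sUnion_entry, → action_mem_of_mem_sUnion_exit,
        → action_mem_of_mem_sUnion_internal]

theorem maxCliques_connGraph (h : E.actions.Nodup) : E.connGraph.maxCliques = E.places := by
  have hd := disjoint_sUnion_internal h
  rw [← Set.sUnion_union] at hd
  exact (((entryGraph_represents h).sup (exitGraph_represents h)
    (disjoint_sUnion_entry_exit E)).sup (internalGraph_represents h) hd).maxCliques_eq

theorem isAntichain_places (h : E.actions.Nodup) : IsAntichain (· ⊆ ·) E.places := by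
  rw [← maxCliques_connGraph h]
  exact fun K hK L hL hne hKL => hne (hKL.antisymm (hK.2 hL.1 hKL))

theorem nonempty_of_mem_places (h : E.actions.Nodup) {Z : Place α} (hZ : Z ∈ E.places) :
    Z.Nonempty := by
  rw [← maxCliques_connGraph h] at hZ
  exact hZ.1.1

theorem inp_notMem_of_mem_entry {Z : Place α} (hZ : Z ∈ E.entry) (a : α) :
    Tagged.inp a ∉ Z := fun ha => by
  obtain ⟨b, hb⟩ := E.sUnion_entry_subset ⟨Z, hZ, ha⟩
  cases hb

theorem out_notMem_of_mem_exit {Z : Place α} (hZ : Z ∈ E.exit) (a : α) :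
    Tagged.out a ∉ Z := fun ha => by
  obtain ⟨b, hb⟩ := E.sUnion_exit_subset ⟨Z, hZ, ha⟩
  cases hb

theorem exists_inp_mem_of_mem_exit {Z : Place α} (hZ : Z ∈ E.exit) : ∃ a, Tagged.inp a ∈ Z := by
  induction E generalizing Z with
  | act a => exact ⟨a, hZ.symm ▸ rfl⟩
  | seq E F _ ihF => exact ihF hZ
  | choice E F ihE _ =>
    obtain ⟨Z, hZ, W, -, rfl⟩ := hZ
    exact (ihE hZ).imp fun _ => .inl
  | par E F ihE ihF => exact hZ.elim ihE ihF
  | iter E F G _ _ ihG => exact ihG hZ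

theorem exists_inp_mem_of_mem_internal {Z : Place α} (hZ : Z ∈ E.internal) :
    ∃ a, Tagged.inp a ∈ Z := by
  induction E generalizing Z with
  | act a => exact hZ.elim
  | choice E F ihE ihF | par E F ihE ihF => exact hZ.elim ihE ihF
  | seq E F ihE ihF =>
    rcases hZ with (hZ | hZ) | ⟨Z, hZ, W, -, rfl⟩
    · exact ihE hZ
    · exact ihF hZ
    · exact (exists_inp_mem_of_mem_exit hZ).imp fun _ => .inl
  | iter E F G ihE ihF ihG =>
    rcases hZ with ((hZ | hZ) | hZ) | ⟨_, ⟨Z, hZ, _, -, rfl⟩, _, -, rfl⟩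
    · exact ihE hZ
    · exact ihF hZ
    · exact ihG hZ
    · exact (exists_inp_mem_of_mem_exit hZ).imp fun _ ha => .inl (.inl ha)

theorem finite_places (E : BoxExpr α) : E.places.Finite := by
  have finite_vertices : {v : Tagged α | v.action ∈ E.actions}.Finite := by
    refine ((E.actions.finite_toSet.image Tagged.inp).union
      (E.actions.finite_toSet.image Tagged.out)).subset ?_
    rintro (a | a) ha
    · exact .inl ⟨a, ha, rfl⟩
    · exact .inr ⟨a, ha, rfl⟩
  exact finite_vertices.finite_subsets.subset fun Z hZ v hv => action_mem hZ hv

end BoxExpr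

/-! ## Restricting a sound net to fewer places -/

namespace PetriNet

section Reachability

variable {π π' τ : Type*} {N : PetriNet π τ} {N' : PetriNet π' τ} {M M' L : Set π} {t : τ}

/-- `N.Leads M M'` if `M'` is obtained from `M` by a finite sequence of firings. -/
def Leads (N : PetriNet π τ) : Set π → Set π → Prop :=
  Relation.ReflTransGen fun M M' => ∃ t, N.Step M t M'

theorem mem_reach_of_step (hM : M ∈ N.reach) (h : N.Step M t M') : M' ∈ N.reach :=
  Relation.ReflTransGen.tail hM ⟨t, h⟩

@[elab_as_elim]
theorem reach_induction {p : ∀ M, M ∈ N.reach → Prop} (init : p N.init N.init_mem_reach)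
    (step : ∀ M t M' (hM : M ∈ N.reach) (h : N.Step M t M'), p M hM → p M' (mem_reach_of_step hM h))
    (hM : M ∈ N.reach) : p M hM := by
  induction hM with
  | refl => exact init
  | tail hM hstep ih => exact step _ _ _ hM hstep.choose_spec ih

theorem Safe.step_left_unique (hN : N.Safe) (hM : M ∈ N.reach) (hM' : M' ∈ N.reach)
    (h : N.Step M t L) (h' : N.Step M' t L) : M = M' := by
  have eq_backward {M : Set π} (hM : M ∈ N.reach) (h : N.Step M t L) :
      M = (L \ N.post t) ∪ N.pre t := by
    have hdisj : Disjoint (M \ N.pre t) (N.post t) :=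
      (Set.disjoint_iff_inter_eq_empty.2 (hN M hM t h.1)).symm
    rw [h.2, Set.union_sdiff_cancel_right hdisj.le_bot, Set.sdiff_union_of_subset h.1.2]
  rw [eq_backward hM h, eq_backward hM' h']

theorem image_reach {f : Set π → Set π'} (init : f N.init = N'.init)
    (map_step : ∀ M ∈ N.reach, ∀ t M', N.Step M t M' → N'.Step (f M) t (f M'))
    (fireable_of_map : ∀ M ∈ N.reach, ∀ t, N'.Fireable (f M) t → N.Fireable M t) :
    f '' N.reach = N'.reach := by
  refine Set.Subset.antisymm ?_ fun L hL => ?_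
  · rintro _ ⟨M, hM, rfl⟩
    induction hM using reach_induction with
    | init => exact init ▸ N'.init_mem_reach
    | step M t M' hM hstep ih => exact mem_reach_of_step ih (map_step M hM t M' hstep)
  · induction hL using reach_induction with
    | init => exact ⟨N.init, N.init_mem_reach, init⟩
    | step L t L' hL hstep ih =>
      obtain ⟨M, hM, rfl⟩ := ih
      have hfire : N.Step M t _ := ⟨fireable_of_map M hM t hstep.1, rfl⟩
      exact ⟨_, mem_reach_of_step hM hfire, (map_step M hM t _ hfire).2.trans hstep.2.symm⟩

theorem rgIso_of_injOn {f : Set π → Set π'} (init : f N.init = N'.init)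
    (map_step : ∀ M ∈ N.reach, ∀ t M', N.Step M t M' → N'.Step (f M) t (f M'))
    (fireable_of_map : ∀ M ∈ N.reach, ∀ t, N'.Fireable (f M) t → N.Fireable M t)
    (injOn : Set.InjOn f N.reach) : N'.RGIso N := by
  have bijOn : Set.BijOn f N.reach N'.reach := by
    rw [← image_reach init map_step fireable_of_map]
    exact injOn.bijOn_image
  have step_iff (M M' : N.reach) (t : τ) : N.Step M t M' ↔ N'.Step (f M) t (f M') := by
    refine ⟨map_step M M.2 t M', fun h => ?_⟩
    have hfire : N.Step M t _ := ⟨fireable_of_map M M.2 t h.1, rfl⟩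
    have heq := injOn (mem_reach_of_step M.2 hfire) M'.2
      ((map_step M M.2 t _ hfire).2.trans h.2.symm)
    rwa [heq] at hfire
  refine ⟨(bijOn.equiv f).symm, ?_, fun L L' t => ?_⟩
  · rw [Equiv.symm_apply_eq]
    exact Subtype.ext init.symm
  · obtain ⟨M, rfl⟩ := (bijOn.equiv f).surjective L
    obtain ⟨M', rfl⟩ := (bijOn.equiv f).surjective L'
    rw [Equiv.symm_apply_apply, Equiv.symm_apply_apply]
    exact (step_iff M M' t).symm

end Reachability

/-- Soundness with respect to a final marking `X`. Besides safeness and proper termination this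
asks that a place is marked once each of its tagged actions lies in some marked place, so that a
reachable marking is determined by the tagged actions in its places. -/
structure IsSound {α : Type*} (N : PetriNet (Place α) α) (X : Set (Place α)) : Prop where
  safe : N.Safe
  leads_final : ∀ M ∈ N.reach, N.Leads M X
  mem_of_subset_sUnion : ∀ M ∈ N.reach, ∀ Z ∈ N.places, Z ⊆ ⋃₀ M → Z ∈ M

end PetriNet

section NetOfPlaces

variable {α : Type*} {P I M L : Set (Place α)} {T : Set α} {t : α}

theorem fireable_netOfPlaces :
    (netOfPlaces P T I).Fireable M t ↔ t ∈ T ∧ ∀ Z ∈ P, Tagged.out t ∈ Z → Z ∈ M :=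
  and_congr_right fun ht =>
    ⟨fun h _ hZ hout => h ⟨hZ, ht, hout⟩, fun h Z hZ => h Z hZ.1 hZ.2.2⟩

theorem step_netOfPlaces :
    (netOfPlaces P T I).Step M t L ↔ (netOfPlaces P T I).Fireable M t ∧
      ∀ Z, Z ∈ L ↔ Z ∈ M ∧ ¬ (Z ∈ P ∧ Tagged.out t ∈ Z) ∨ Z ∈ P ∧ Tagged.inp t ∈ Z := by
  refine and_congr_right fun h => ?_
  have ht := h.1
  simp only [netOfPlaces] at ht
  simp [Set.ext_iff, PetriNet.pre, PetriNet.post, netOfPlaces, ht]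

theorem safe_netOfPlaces :
    (netOfPlaces P T I).Safe ↔ ∀ M ∈ (netOfPlaces P T I).reach, ∀ t,
      (netOfPlaces P T I).Fireable M t → ∀ Z ∈ P, Z ∈ M → Tagged.inp t ∈ Z → Tagged.out t ∈ Z := by
  refine forall₂_congr fun M _ => forall₂_congr fun t h => ?_
  have ht := h.1
  simp only [netOfPlaces] at ht
  simp only [Set.eq_empty_iff_forall_notMem, PetriNet.pre, PetriNet.post, netOfPlaces, ht,
    Set.mem_inter_iff, Set.mem_sdiff, Set.mem_ofPred_eq]
  grind

theorem reach_netOfPlaces_subset (hI : I ⊆ P) (hM : M ∈ (netOfPlaces P T I).reach) : M ⊆ P := by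
  induction hM using PetriNet.reach_induction with
  | init => exact hI
  | step M t L _ hstep ih =>
    have := (step_netOfPlaces.1 hstep).2
    grind

theorem isMarkedNet_netOfPlaces (hP : P.Finite) (hT : T.Finite) (hI : I ⊆ P)
    (hplace : ∀ Z ∈ P, ∃ v ∈ Z, v.action ∈ T) (htrans : ∀ t ∈ T, ∃ Z ∈ P, Tagged.out t ∈ Z) :
    (netOfPlaces P T I).IsMarkedNet where
  finite_places := hP
  finite_trans := hT
  arcTP_mem _ _ h := ⟨h.1, h.2.1⟩
  arcPT_mem _ _ h := ⟨h.1, h.2.1⟩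
  init_subset := hI
  place_connected Z hZ := by
    obtain ⟨a | a, hv, ha⟩ := hplace Z hZ
    · exact .inl ⟨a, ha, hZ, hv⟩
    · exact .inr ⟨a, hZ, ha, hv⟩
  pre_nonempty t ht := by
    obtain ⟨Z, hZ, hout⟩ := htrans t ht
    exact ⟨Z, hZ, ht, hout⟩

end NetOfPlaces

section Restriction

variable {α : Type*} {P C I X M L : Set (Place α)} {T : Set α} {t : α}

/-- The places in `C` suffice to see, for each `t`, which tagged actions share a place of `P` with
`t^out`. -/
def CoversOutputs (P C : Set (Place α)) : Prop :=
  ∀ Z ∈ P, ∀ t, Tagged.out t ∈ Z → ∀ v ∈ Z, ∃ Z' ∈ C, Tagged.out t ∈ Z' ∧ v ∈ Z'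

theorem step_inter (hC : C ⊆ P) (h : (netOfPlaces P T I).Step M t L) :
    (netOfPlaces C T (I ∩ C)).Step (M ∩ C) t (L ∩ C) := by
  simp only [step_netOfPlaces, fireable_netOfPlaces] at h ⊢
  grind

theorem fireable_of_fireable_inter (hcov : CoversOutputs P C)
    (hN : (netOfPlaces P T I).IsSound X) (hM : M ∈ (netOfPlaces P T I).reach)
    (h : (netOfPlaces C T (I ∩ C)).Fireable (M ∩ C) t) : (netOfPlaces P T I).Fireable M t := by
  rw [fireable_netOfPlaces] at h ⊢
  refine ⟨h.1, fun Z hZ hout => hN.mem_of_subset_sUnion M hM Z hZ fun v hv => ?_⟩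
  obtain ⟨Z', hZ', hout', hv'⟩ := hcov Z hZ t hout v hv
  exact ⟨Z', (h.2 Z' hZ' hout').1, hv'⟩

theorem injOn_inter (hC : C ⊆ P) (hcov : CoversOutputs P C)
    (htrans : ∀ t ∈ T, ∃ Z ∈ P, Tagged.out t ∈ Z) (hX : ∀ Z ∈ X, ∀ t, Tagged.out t ∉ Z)
    (hN : (netOfPlaces P T I).IsSound X) :
    Set.InjOn (· ∩ C) (netOfPlaces P T I).reach := by
  intro M hM M' hM' (heq : M ∩ C = M' ∩ C)
  induction hN.leads_final M hM using Relation.ReflTransGen.head_induction_on generalizing M' with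
  | refl =>
    rcases (hN.leads_final M' hM').cases_head with hX' | ⟨L, ⟨t, hstep⟩, -⟩
    · exact hX'.symm
    · have hfire := fireable_netOfPlaces.1 hstep.1
      obtain ⟨Z, hZ, hout⟩ := htrans t hfire.1
      obtain ⟨Z', hZ', hout', -⟩ := hcov Z hZ t hout _ hout
      have hmem : Z' ∈ X ∩ C := heq.symm ▸ ⟨hfire.2 Z' (hC hZ') hout', hZ'⟩
      exact (hX Z' hmem.1 t hout').elim
  | head hstep _ ih =>
    obtain ⟨t, hstep⟩ := hstep
    have hstep' : (netOfPlaces P T I).Step M' t _ :=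
      ⟨fireable_of_fireable_inter hcov hN hM' (heq ▸ (step_inter hC hstep).1), rfl⟩
    have hL := ih (PetriNet.mem_reach_of_step hM hstep) (PetriNet.mem_reach_of_step hM' hstep')
      ((step_inter hC hstep).2.trans (heq ▸ (step_inter hC hstep').2.symm))
    exact hN.safe.step_left_unique hM hM' hstep (hL ▸ hstep')

theorem safe_inter (hC : C ⊆ P) (hcov : CoversOutputs P C)
    (hN : (netOfPlaces P T I).IsSound X) : (netOfPlaces C T (I ∩ C)).Safe := by
  rw [safe_netOfPlaces, ← PetriNet.image_reach (N := netOfPlaces P T I) (f := (· ∩ C)) rfl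
    (fun M _ t L => step_inter hC) fun M hM t => fireable_of_fireable_inter hcov hN hM]
  rintro _ ⟨M, hM, rfl⟩ t h Z hZ hZM
  exact safe_netOfPlaces.1 hN.safe M hM t (fireable_of_fireable_inter hcov hN hM h) Z (hC hZ) hZM.1

theorem rgIso_inter (hC : C ⊆ P) (hcov : CoversOutputs P C)
    (htrans : ∀ t ∈ T, ∃ Z ∈ P, Tagged.out t ∈ Z) (hX : ∀ Z ∈ X, ∀ t, Tagged.out t ∉ Z)
    (hN : (netOfPlaces P T I).IsSound X) :
    (netOfPlaces C T (I ∩ C)).RGIso (netOfPlaces P T I) :=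
  PetriNet.rgIso_of_injOn (f := (· ∩ C)) rfl (fun _ _ _ _ => step_inter hC)
    (fun _ hM _ => fireable_of_fireable_inter hcov hN hM) (injOn_inter hC hcov htrans hX hN)

end Restriction

/-! ## Markings of boxes -/

namespace BoxExpr

variable {α : Type*} {E F : BoxExpr α} {M L : Set (Place α)} {t : α}

theorem box_eq (E : BoxExpr α) : E.box = netOfPlaces E.places {a | a ∈ E.actions} E.entry := rfl

/-- No reachable marking of `BOX(E)` marks an entry place and an exit place at the same time. Then
`BOX(E)` can be the body of a loop, where entry and exit places get merged. -/
def IsExclusive (E : BoxExpr α) : Prop :=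
  ∀ M ∈ E.box.reach, ∀ Z ∈ E.entry, Z ∈ M → ∀ W ∈ E.exit, W ∉ M

theorem exists_out_mem_places (ht : t ∈ E.actions) : ∃ Z ∈ E.places, Tagged.out t ∈ Z :=
  E.exists_mem_places (v := .out t) ht

theorem exists_inp_mem_places (ht : t ∈ E.actions) : ∃ Z ∈ E.places, Tagged.inp t ∈ Z :=
  E.exists_mem_places (v := .inp t) ht

theorem fireable_box :
    E.box.Fireable M t ↔ t ∈ E.actions ∧ ∀ Z ∈ E.places, Tagged.out t ∈ Z → Z ∈ M :=
  fireable_netOfPlaces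

theorem step_box : E.box.Step M t L ↔ E.box.Fireable M t ∧
    ∀ Z, Z ∈ L ↔ Z ∈ M ∧ ¬ (Z ∈ E.places ∧ Tagged.out t ∈ Z) ∨ Z ∈ E.places ∧ Tagged.inp t ∈ Z :=
  step_netOfPlaces

theorem safe_box : E.box.Safe ↔ ∀ M ∈ E.box.reach, ∀ t, E.box.Fireable M t →
    ∀ Z ∈ E.places, Z ∈ M → Tagged.inp t ∈ Z → Tagged.out t ∈ Z :=
  safe_netOfPlaces

theorem reach_box_subset (hM : M ∈ E.box.reach) : M ⊆ E.places :=
  reach_netOfPlaces_subset E.entry_subset_places hM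

/-- Once an entry place has been emptied, it stays so, as it has no input transition. -/
theorem eq_entry_of_entry_subset (hM : M ∈ E.box.reach) (hentry : E.entry ⊆ M) :
    M = E.entry := by
  suffices M = E.entry ∨ ∃ Z ∈ E.entry, Z ∉ M from
    this.resolve_right fun ⟨Z, hZ, hZM⟩ => hZM (hentry hZ)
  clear hentry
  induction hM using PetriNet.reach_induction with
  | init => exact .inl rfl
  | step M t L hM hstep ih =>
    have hmem := (step_box.1 hstep).2
    right
    rcases ih with rfl | ⟨Z, hZ, hZM⟩
    · obtain ⟨ht, hpre⟩ := fireable_box.1 hstep.1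
      obtain ⟨Z, hZ, hout⟩ := exists_out_mem_places ht
      refine ⟨Z, hpre Z hZ hout, fun hZL => ?_⟩
      rcases (hmem Z).1 hZL with ⟨-, hnot⟩ | ⟨-, hinp⟩
      · exact hnot ⟨hZ, hout⟩
      · exact inp_notMem_of_mem_entry (hpre Z hZ hout) t hinp
    · refine ⟨Z, hZ, fun hZL => ?_⟩
      rcases (hmem Z).1 hZL with ⟨hZM', -⟩ | ⟨-, hinp⟩
      · exact hZM hZM'
      · exact inp_notMem_of_mem_entry hZ t hinp

theorem eq_exit_of_exit_subset (hE : E.box.IsSound E.exit) (hM : M ∈ E.box.reach)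
    (hexit : E.exit ⊆ M) : M = E.exit := by
  induction hE.leads_final M hM using Relation.ReflTransGen.head_induction_on with
  | refl => rfl
  | @head M L hstep _ ih =>
    obtain ⟨t, hstep⟩ := hstep
    have hmem := (step_box.1 hstep).2
    have hL : L = E.exit := ih (PetriNet.mem_reach_of_step hM hstep) fun Z hZ =>
      (hmem Z).2 (.inl ⟨hexit hZ, fun hout => out_notMem_of_mem_exit hZ t hout.2⟩)
    obtain ⟨Z, hZ, hinp⟩ := exists_inp_mem_places (fireable_box.1 hstep.1).1
    have hZexit : Z ∈ E.exit := hL ▸ (hmem Z).2 (.inr ⟨hZ, hinp⟩)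
    have hout := safe_box.1 hE.safe M hM t hstep.1 Z hZ (hexit hZexit) hinp
    exact (out_notMem_of_mem_exit hZexit t hout).elim

theorem places_act (a : α) : (act a).places = {{Tagged.out a}, {Tagged.inp a}} := by
  rw [places, entry, exit, internal, Set.union_empty, Set.insert_eq]

theorem fireable_box_act {a : α} :
    (act a).box.Fireable M t ↔ t = a ∧ {Tagged.out a} ∈ M := by
  simp +contextual [fireable_box, places_act, actions]

theorem step_act (a : α) : (act a).box.Step {{Tagged.out a}} a {{Tagged.inp a}} := by
  rw [step_box, fireable_box_act, places_act]
  refine ⟨⟨rfl, rfl⟩, fun Z => ?_⟩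
  simp only [Set.mem_insert_iff, Set.mem_singleton_iff]
  grind

theorem reach_box_act {a : α} (hM : M ∈ (act a).box.reach) :
    M = {{Tagged.out a}} ∨ M = {{Tagged.inp a}} := by
  induction hM using PetriNet.reach_induction with
  | init => exact .inl rfl
  | step M t L hM hstep ih =>
    obtain ⟨rfl, hout⟩ := fireable_box_act.1 hstep.1
    rcases ih with rfl | rfl
    · exact .inr (hstep.2.trans (step_act t).2.symm)
    · simp at hout

theorem isExclusive_act (a : α) : (act a).IsExclusive := by
  rintro M hM Z (rfl : Z = _) hZ W (rfl : W = _) hW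
  rcases reach_box_act hM with rfl | rfl
  · simp at hW
  · simp at hZ

theorem isSound_act (a : α) : (act a).box.IsSound (act a).exit where
  safe := by
    rw [safe_box]
    intro M hM t h Z hZ hZM _
    obtain ⟨rfl, hout⟩ := fireable_box_act.1 h
    rcases reach_box_act hM with rfl | rfl
    · simp_all
    · simp at hout
  leads_final M hM := by
    rcases reach_box_act hM with rfl | rfl
    · exact .single ⟨a, step_act a⟩
    · exact .refl
  mem_of_subset_sUnion M hM Z hZ hsub := by
    rw [box_eq, netOfPlaces, places_act] at hZ
    rcases reach_box_act hM with rfl | rfl <;> rcases hZ with rfl | rfl <;> simp_all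

end BoxExpr

namespace BoxExpr

variable {α : Type*} {E F : BoxExpr α} {A B L M : Set (Place α)} {t : α}

theorem places_par (E F : BoxExpr α) : (par E F).places = E.places ∪ F.places := by
  simp only [places, entry, exit, internal]
  ac_rfl

theorem par_box_comm (E F : BoxExpr α) : (par E F).box = (par F E).box := by
  have actions_comm : {a | a ∈ (par E F).actions} = {a | a ∈ (par F E).actions} := by
    simp only [actions, List.mem_append, or_comm]
  rw [box_eq, box_eq, places_par, places_par, Set.union_comm, actions_comm, entry, entry,
    Set.union_comm E.entry]

theorem notMem_places_of_action_mem (h : E.actions.Disjoint F.actions) {Z : Place α}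
    {v : Tagged α} (hv : v.action ∈ E.actions) (hvZ : v ∈ Z) : Z ∉ F.places :=
  fun hZ => h hv (action_mem hZ hvZ)

theorem fireable_par (h : E.actions.Disjoint F.actions) (hB : B ⊆ F.places)
    (ht : t ∈ E.actions) : (par E F).box.Fireable (A ∪ B) t ↔ E.box.Fireable A t := by
  simp only [fireable_box, places_par, actions, List.mem_append, Set.mem_union, ht, true_or,
    true_and]
  have hout (Z : Place α) := notMem_places_of_action_mem (v := .out t) (Z := Z) h ht
  grind

theorem step_par (h : E.actions.Disjoint F.actions) (hB : B ⊆ F.places)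
    (hstep : E.box.Step A t L) : (par E F).box.Step (A ∪ B) t (L ∪ B) := by
  have ht := (fireable_box.1 hstep.1).1
  obtain ⟨hfire, hmem⟩ := step_box.1 hstep
  refine step_box.2 ⟨(fireable_par h hB ht).2 hfire, fun Z => ?_⟩
  have hout := notMem_places_of_action_mem (v := .out t) (Z := Z) h ht
  have hinp := notMem_places_of_action_mem (v := .inp t) (Z := Z) h ht
  simp only [places_par, Set.mem_union, hmem]
  grind

theorem exists_step_of_step_par (h : E.actions.Disjoint F.actions) (hB : B ⊆ F.places)
    (ht : t ∈ E.actions) (hstep : (par E F).box.Step (A ∪ B) t L) :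
    ∃ A', E.box.Step A t A' ∧ L = A' ∪ B := by
  have hstep' : E.box.Step A t _ := ⟨(fireable_par h hB ht).1 hstep.1, rfl⟩
  exact ⟨_, hstep', hstep.2.trans (step_par h hB hstep').2.symm⟩

theorem exists_eq_union_of_mem_reach_par (h : E.actions.Disjoint F.actions)
    (hM : M ∈ (par E F).box.reach) : ∃ A ∈ E.box.reach, ∃ B ∈ F.box.reach, M = A ∪ B := by
  induction hM using PetriNet.reach_induction with
  | init => exact ⟨_, E.box.init_mem_reach, _, F.box.init_mem_reach, rfl⟩
  | step M t L hM hstep ih =>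
    obtain ⟨A, hA, B, hB, rfl⟩ := ih
    rcases List.mem_append.1 (fireable_box.1 hstep.1).1 with ht | ht
    · obtain ⟨A', hA', rfl⟩ := exists_step_of_step_par h (reach_box_subset hB) ht hstep
      exact ⟨A', PetriNet.mem_reach_of_step hA hA', B, hB, rfl⟩
    · rw [par_box_comm, Set.union_comm] at hstep
      obtain ⟨B', hB', rfl⟩ := exists_step_of_step_par h.symm (reach_box_subset hA) ht hstep
      exact ⟨A, hA, B', PetriNet.mem_reach_of_step hB hB', Set.union_comm _ _⟩

theorem leads_par (h : E.actions.Disjoint F.actions) (hB : B ⊆ F.places)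
    (hlead : E.box.Leads A L) : (par E F).box.Leads (A ∪ B) (L ∪ B) :=
  Relation.ReflTransGen.lift (· ∪ B) (fun _ _ ⟨t, ht⟩ => ⟨t, step_par h hB ht⟩) _ _ hlead

theorem safe_par_left (h : E.actions.Disjoint F.actions) (hE : E.box.Safe) (hA : A ∈ E.box.reach)
    (hB : B ⊆ F.places) (ht : t ∈ E.actions) (hfire : (par E F).box.Fireable (A ∪ B) t)
    {Z : Place α} (hZ : Z ∈ A ∪ B) (hinp : Tagged.inp t ∈ Z) : Tagged.out t ∈ Z := by
  have hZA : Z ∈ A := hZ.resolve_right fun hZB => h ht (action_mem (hB hZB) hinp)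
  exact safe_box.1 hE A hA t ((fireable_par h hB ht).1 hfire) Z
    (reach_box_subset hA hZA) hZA hinp

theorem mem_of_subset_sUnion_par_left (h : E.actions.Disjoint F.actions)
    (hE : E.box.IsSound E.exit) (hA : A ∈ E.box.reach) (hB : B ⊆ F.places) {Z : Place α}
    (hZ : Z ∈ E.places) (hsub : Z ⊆ ⋃₀ (A ∪ B)) : Z ∈ A := by
  refine hE.mem_of_subset_sUnion A hA Z hZ fun v hv => ?_
  obtain ⟨W, hW | hW, hvW⟩ := hsub hv
  · exact ⟨W, hW, hvW⟩
  · exact (h (action_mem hZ hv) (action_mem (hB hW) hvW)).elim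

theorem isSound_par (h : E.actions.Disjoint F.actions) (hE : E.box.IsSound E.exit)
    (hF : F.box.IsSound F.exit) : (par E F).box.IsSound (par E F).exit where
  safe := by
    rw [safe_box]
    intro M hM t hfire Z _ hZM hinp
    obtain ⟨A, hA, B, hB, rfl⟩ := exists_eq_union_of_mem_reach_par h hM
    rcases List.mem_append.1 (fireable_box.1 hfire).1 with ht | ht
    · exact safe_par_left h hE.safe hA (reach_box_subset hB) ht hfire hZM hinp
    · rw [par_box_comm] at hfire
      rw [Set.union_comm] at hfire hZM
      exact safe_par_left h.symm hF.safe hB (reach_box_subset hA) ht hfire hZM hinp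
  leads_final M hM := by
    obtain ⟨A, hA, B, hB, rfl⟩ := exists_eq_union_of_mem_reach_par h hM
    have left := leads_par h (reach_box_subset hB) (hE.leads_final A hA)
    have right := leads_par h.symm E.exit_subset_places (hF.leads_final B hB)
    rw [par_box_comm, Set.union_comm, Set.union_comm F.exit] at right
    exact left.trans right
  mem_of_subset_sUnion M hM Z hZ hsub := by
    obtain ⟨A, hA, B, hB, rfl⟩ := exists_eq_union_of_mem_reach_par h hM
    rcases (places_par E F ▸ hZ : Z ∈ E.places ∪ F.places) with hZ | hZ
    · exact .inl (mem_of_subset_sUnion_par_left h hE hA (reach_box_subset hB) hZ hsub)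
    · rw [Set.union_comm] at hsub
      exact .inr (mem_of_subset_sUnion_par_left h.symm hF hB (reach_box_subset hA) hZ hsub)

end BoxExpr

/-! ## Gluing boxes along a graph -/

/-- The iterated cross-product of the sets of places `A p` with `p ∈ S`: its elements are the unions
`⋃ p ∈ S, c p` for the families of places `c p ∈ A p`. -/
def prodOver {ι α : Type*} (S : Set ι) (A : ι → Set (Place α)) : Set (Place α) :=
  {Z | ∃ c : ι → Place α, (∀ p ∈ S, c p ∈ A p) ∧ Z = ⋃ p ∈ S, c p}

section ProdOver

variable {ι α : Type*} {S : Set ι} {p : ι} (A : ι → Set (Place α))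

theorem prodOver_singleton (p : ι) : prodOver {p} A = A p := by
  ext Z
  constructor
  · rintro ⟨c, hc, rfl⟩
    simpa using hc
  · intro hZ
    exact ⟨fun _ => Z, by simpa using hZ, by simp⟩

theorem prodOver_insert (hp : p ∉ S) :
    prodOver (insert p S) A = crossProd (A p) (prodOver S A) := by
  classical
  ext Z
  constructor
  · rintro ⟨c, hc, rfl⟩
    exact ⟨c p, hc p (.inl rfl), _, ⟨c, fun q hq => hc q (.inr hq), rfl⟩,
      (Set.biUnion_insert p S c).symm⟩
  · rintro ⟨Z, hZ, _, ⟨c, hc, rfl⟩, rfl⟩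
    have update_of_mem {q : ι} (hq : q ∈ S) : Function.update c p Z q = c q :=
      Function.update_of_ne (ne_of_mem_of_not_mem hq hp) _ _
    refine ⟨Function.update c p Z, ?_, ?_⟩
    · rintro q (rfl | hq)
      · rwa [Function.update_self]
      · rw [update_of_mem hq]
        exact hc q hq
    · rw [Set.biUnion_insert, Function.update_self]
      exact congrArg (Z ∪ ·) (Set.iUnion₂_congr fun q hq => (update_of_mem hq).symm)

end ProdOver

/-- Box expressions with pairwise different actions, arranged as the arcs `src j ⟶ tgt j` of a
directed graph. Sequence, choice and iteration all arise by gluing boxes along such a graph. -/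
structure BoxGraph (ι κ α : Type*) where
  box : ι → BoxExpr α
  src : ι → κ
  tgt : ι → κ
  nodup : ∀ j, (box j).actions.Nodup
  disjoint : Pairwise fun i j => (box i).actions.Disjoint (box j).actions

namespace BoxGraph

variable {ι κ α : Type*} (G : BoxGraph ι κ α)

/-- The entry places (port `inl j`) and the exit places (port `inr j`) of the `j`-th box. -/
def port : ι ⊕ ι → Set (Place α) :=
  Sum.elim (fun j => (G.box j).entry) fun j => (G.box j).exit

/-- The index of the box that a port belongs to. -/
def owner : ι ⊕ ι → ι := Sum.elim id id

/-- The node of the graph that a port is attached to. -/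
def node : ι ⊕ ι → κ := Sum.elim G.src G.tgt

/-- The places obtained by merging all the ports at the node `k`. -/
def junction (k : κ) : Set (Place α) := prodOver {p | G.node p = k} G.port

/-- The places of the glued net. -/
def places : Set (Place α) := (⋃ j, (G.box j).internal) ∪ ⋃ p, G.junction (G.node p)

/-- The net obtained from the boxes by merging the ports at each node, with the initial marking at
the node `k`. -/
def net (k : κ) : PetriNet (Place α) α :=
  netOfPlaces G.places {a | ∃ j, a ∈ (G.box j).actions} (G.junction k)

/-- The marking of the glued net that corresponds to a marking of one of the boxes. -/
def lift (M : Set (Place α)) : Set (Place α) := {P ∈ G.places | ∃ Z ∈ M, Z ⊆ P}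

section Places

variable {G} {i j : ι} {k : κ} {p q : ι ⊕ ι} {P Z W : Place α} {v : Tagged α}

theorem eq_of_mem_places (hZ : Z ∈ (G.box i).places) (hW : W ∈ (G.box j).places) (hvZ : v ∈ Z)
    (hvW : v ∈ W) : i = j :=
  G.disjoint.eq fun h => h (BoxExpr.action_mem hZ hvZ) (BoxExpr.action_mem hW hvW)

theorem nonempty_of_mem_box (hZ : Z ∈ (G.box j).places) : Z.Nonempty :=
  BoxExpr.nonempty_of_mem_places (G.nodup j) hZ

theorem port_subset (p : ι ⊕ ι) : G.port p ⊆ (G.box (owner p)).places := by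
  rcases p with j | j
  · exact (G.box j).entry_subset_places
  · exact (G.box j).exit_subset_places

theorem port_nonempty (p : ι ⊕ ι) : (G.port p).Nonempty := by
  rcases p with j | j
  · exact (G.box j).entry_nonempty
  · exact (G.box j).exit_nonempty

theorem mem_box_places : Z ∈ (G.box j).places ↔
    Z ∈ (G.box j).internal ∨ ∃ p : ι ⊕ ι, owner p = j ∧ Z ∈ G.port p := by
  simp only [BoxExpr.places, Set.mem_union, Sum.exists, owner, port, Sum.elim_inl, Sum.elim_inr, id,
    exists_eq_left]
  tauto

theorem eq_of_mem_port (hZ : Z ∈ G.port p) (hW : W ∈ G.port q) (hvZ : v ∈ Z) (hvW : v ∈ W) :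
    p = q := by
  have howner := eq_of_mem_places (port_subset p hZ) (port_subset q hW) hvZ hvW
  rcases p with i | i <;> rcases q with j | j
  · exact congrArg Sum.inl howner
  · exact ((BoxExpr.disjoint_sUnion_entry_exit _).le_bot ⟨⟨Z, hZ, hvZ⟩, ⟨W, hW, hvW⟩⟩).elim
  · exact ((BoxExpr.disjoint_sUnion_entry_exit _).le_bot ⟨⟨W, hW, hvW⟩, ⟨Z, hZ, hvZ⟩⟩).elim
  · exact congrArg Sum.inr howner

theorem notMem_internal_of_mem_port (hZ : Z ∈ G.port p) (hvZ : v ∈ Z) (hvW : v ∈ W) :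
    W ∉ (G.box j).internal := by
  intro hW
  have howner : owner p = j := eq_of_mem_places (port_subset p hZ) (.inr hW) hvZ hvW
  have hd := (BoxExpr.disjoint_sUnion_internal (G.nodup j)).notMem_of_mem_right ⟨W, hW, hvW⟩
  rcases p with i | i <;> obtain rfl : i = j := howner
  · exact hd (.inl ⟨Z, hZ, hvZ⟩)
  · exact hd (.inr ⟨Z, hZ, hvZ⟩)

theorem junction_subset_places (p : ι ⊕ ι) : G.junction (G.node p) ⊆ G.places :=
  fun _ hP => .inr (Set.mem_iUnion.2 ⟨p, hP⟩)

theorem internal_subset_places (j : ι) : (G.box j).internal ⊆ G.places :=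
  fun _ hP => .inl (Set.mem_iUnion.2 ⟨j, hP⟩)

theorem exists_port_of_mem_junction (hP : P ∈ G.junction k) (hv : v ∈ P) :
    ∃ p, G.node p = k ∧ ∃ Z ∈ G.port p, v ∈ Z ∧ Z ⊆ P := by
  obtain ⟨c, hc, rfl⟩ := hP
  obtain ⟨p, hp, hvp⟩ := Set.mem_iUnion₂.1 hv
  exact ⟨p, hp, c p, hc p hp, hvp, Set.subset_biUnion_of_mem hp⟩

theorem exists_mem_port_subset (hP : P ∈ G.junction (G.node p)) : ∃ Z ∈ G.port p, Z ⊆ P := by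
  obtain ⟨c, hc, rfl⟩ := hP
  exact ⟨c p, hc p rfl, Set.subset_biUnion_of_mem rfl⟩

/-- A member of `junction k` is the union of one place from each port at `k`, and these do not
overlap. -/
theorem eq_of_subset_of_mem_junction (hP : P ∈ G.junction k) (hZ : Z ∈ G.port p)
    (hW : W ∈ G.port p) (hZP : Z ⊆ P) (hWP : W ⊆ P) : Z = W := by
  obtain ⟨c, hc, rfl⟩ := hP
  have eq_choice {Z : Place α} (hZ : Z ∈ G.port p) (hsub : Z ⊆ ⋃ q ∈ {q | G.node q = k}, c q) :
      Z = c p := by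
    have hZc (v : Tagged α) (hv : v ∈ Z) : G.node p = k ∧ v ∈ c p := by
      obtain ⟨q, hq, hvq⟩ := Set.mem_iUnion₂.1 (hsub hv)
      obtain rfl := eq_of_mem_port hZ (hc q hq) hv hvq
      exact ⟨hq, hvq⟩
    obtain ⟨v, hv⟩ := nonempty_of_mem_box (port_subset p hZ)
    exact (BoxExpr.isAntichain_places (G.nodup _)).eq (port_subset p hZ)
      (port_subset p (hc p (hZc v hv).1)) fun v hv => (hZc v hv).2
  exact (eq_choice hZ hZP).trans (eq_choice hW hWP).symm

theorem mem_internal_of_mem (hP : P ∈ G.places) (hvP : v ∈ P) (hZ : Z ∈ (G.box j).internal)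
    (hvZ : v ∈ Z) : P ∈ (G.box j).internal := by
  rcases hP with hP | hP
  · obtain ⟨i, hP⟩ := Set.mem_iUnion.1 hP
    obtain rfl : i = j := eq_of_mem_places (.inr hP) (.inr hZ) hvP hvZ
    exact hP
  · obtain ⟨p, hP⟩ := Set.mem_iUnion.1 hP
    obtain ⟨q, -, W, hW, hvW, -⟩ := exists_port_of_mem_junction hP hvP
    exact (notMem_internal_of_mem_port hW hvW hvZ hZ).elim

theorem mem_junction_of_mem (hP : P ∈ G.places) (hvP : v ∈ P) (hZ : Z ∈ G.port p) (hvZ : v ∈ Z) :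
    P ∈ G.junction (G.node p) ∧ ∃ W ∈ G.port p, v ∈ W ∧ W ⊆ P := by
  rcases hP with hP | hP
  · obtain ⟨i, hP⟩ := Set.mem_iUnion.1 hP
    exact (notMem_internal_of_mem_port hZ hvZ hvP hP).elim
  · obtain ⟨q, hP⟩ := Set.mem_iUnion.1 hP
    obtain ⟨r, hr, W, hW, hvW, hWP⟩ := exists_port_of_mem_junction hP hvP
    obtain rfl := eq_of_mem_port hW hZ hvW hvZ
    exact ⟨hr ▸ hP, W, hW, hvW, hWP⟩

theorem exists_box_place_subset (hP : P ∈ G.places) (hvP : v ∈ P)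
    (hv : v.action ∈ (G.box j).actions) : ∃ Z ∈ (G.box j).places, v ∈ Z ∧ Z ⊆ P := by
  obtain ⟨Z, hZ, hvZ⟩ := (G.box j).exists_mem_places hv
  rcases mem_box_places.1 hZ with hint | ⟨p, rfl, hport⟩
  · exact ⟨P, .inr (mem_internal_of_mem hP hvP hint hvZ), hvP, subset_rfl⟩
  · obtain ⟨-, W, hW, hvW, hWP⟩ := mem_junction_of_mem hP hvP hport hvZ
    exact ⟨W, port_subset p hW, hvW, hWP⟩

theorem eq_of_subset_of_mem_internal (hP : P ∈ (G.box i).internal) (hZ : Z ∈ (G.box j).places)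
    (hZP : Z ⊆ P) : Z = P := by
  obtain ⟨v, hv⟩ := nonempty_of_mem_box hZ
  obtain rfl : j = i := eq_of_mem_places hZ (.inr hP) hv (hZP hv)
  exact (BoxExpr.isAntichain_places (G.nodup j)).eq hZ (.inr hP) hZP

theorem mem_junction_of_subset (hP : P ∈ G.places) (hZ : Z ∈ G.port p) (hZP : Z ⊆ P) :
    P ∈ G.junction (G.node p) := by
  obtain ⟨v, hv⟩ := nonempty_of_mem_box (port_subset p hZ)
  exact (mem_junction_of_mem hP (hZP hv) hZ hv).1

theorem exists_port_of_subset (hP : P ∈ G.junction k) (hZ : Z ∈ (G.box j).places) (hZP : Z ⊆ P) :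
    ∃ p, owner p = j ∧ G.node p = k ∧ Z ∈ G.port p := by
  obtain ⟨v, hv⟩ := nonempty_of_mem_box hZ
  obtain ⟨p, rfl, W, hW, hvW, -⟩ := exists_port_of_mem_junction hP (hZP hv)
  rcases mem_box_places.1 hZ with hint | ⟨q, rfl, hport⟩
  · exact (notMem_internal_of_mem_port hW hvW hv hint).elim
  · obtain rfl := eq_of_mem_port hW hport hvW hv
    exact ⟨p, rfl, rfl, hport⟩

theorem lift_port (p : ι ⊕ ι) : G.lift (G.port p) = G.junction (G.node p) := by
  ext P
  constructor
  · rintro ⟨hP, Z, hZ, hZP⟩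
    exact mem_junction_of_subset hP hZ hZP
  · intro hP
    exact ⟨junction_subset_places p hP, exists_mem_port_subset hP⟩

end Places

end BoxGraph

namespace BoxGraph

/-- The conditions on the boxes under which gluing yields a sound net. -/
structure IsSound {ι κ α : Type*} (G : BoxGraph ι κ α) : Prop where
  sound : ∀ j, (G.box j).box.IsSound (G.box j).exit
  exclusive_of_loop : ∀ j, G.src j = G.tgt j → (G.box j).IsExclusive

variable {ι κ α : Type*} {G : BoxGraph ι κ α} {i j : ι} {k : κ} {p q r : ι ⊕ ι}
  {P Q Z W : Place α} {M L : Set (Place α)} {t : α} {v : Tagged α}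

theorem fireable_net :
    (G.net k).Fireable M t ↔
      (∃ j, t ∈ (G.box j).actions) ∧ ∀ Z ∈ G.places, Tagged.out t ∈ Z → Z ∈ M :=
  fireable_netOfPlaces

theorem owner_eq_of_mem (hM : M ∈ (G.box j).box.reach) (hZ : Z ∈ M) (hport : Z ∈ G.port p) :
    owner p = j := by
  have hZj := BoxExpr.reach_box_subset hM hZ
  obtain ⟨v, hv⟩ := nonempty_of_mem_box hZj
  exact eq_of_mem_places (port_subset p hport) hZj hv hv

theorem IsSound.port_eq (hG : G.IsSound) (hM : M ∈ (G.box j).box.reach) (hZM : Z ∈ M)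
    (hWM : W ∈ M) (hZ : Z ∈ G.port p) (hW : W ∈ G.port q) (hpq : G.node p = G.node q) :
    p = q := by
  have hp := owner_eq_of_mem hM hZM hZ
  have hq := owner_eq_of_mem hM hWM hW
  rcases p with p | p <;> rcases q with q | q <;> obtain rfl : p = j := hp <;>
    obtain rfl : q = p := hq
  · rfl
  · exact (hG.exclusive_of_loop _ hpq M hM Z hZ hZM W hW hWM).elim
  · exact (hG.exclusive_of_loop _ hpq.symm M hM W hW hWM Z hZ hZM).elim
  · rfl

theorem IsSound.eq_of_subset (hG : G.IsSound) (hM : M ∈ (G.box j).box.reach) (hP : P ∈ G.places)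
    (hZM : Z ∈ M) (hWM : W ∈ M) (hZP : Z ⊆ P) (hWP : W ⊆ P) : Z = W := by
  have hZ := BoxExpr.reach_box_subset hM hZM
  have hW := BoxExpr.reach_box_subset hM hWM
  rcases hP with hP | hP
  · obtain ⟨i, hP⟩ := Set.mem_iUnion.1 hP
    exact (eq_of_subset_of_mem_internal hP hZ hZP).trans
      (eq_of_subset_of_mem_internal hP hW hWP).symm
  · obtain ⟨r, hP⟩ := Set.mem_iUnion.1 hP
    obtain ⟨p, -, hp, hZp⟩ := exists_port_of_subset hP hZ hZP
    obtain ⟨q, -, hq, hWq⟩ := exists_port_of_subset hP hW hWP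
    obtain rfl := hG.port_eq hM hZM hWM hZp hWq (hp.trans hq.symm)
    exact eq_of_subset_of_mem_junction hP hZp hWq hZP hWP

theorem fireable_lift (hfire : (G.box j).box.Fireable M t) :
    (G.net k).Fireable (G.lift M) t := by
  obtain ⟨ht, hpre⟩ := BoxExpr.fireable_box.1 hfire
  refine fireable_net.2 ⟨⟨j, ht⟩, fun P hP hout => ⟨hP, ?_⟩⟩
  obtain ⟨Z, hZ, houtZ, hZP⟩ := exists_box_place_subset hP hout ht
  exact ⟨Z, hpre Z hZ houtZ, hZP⟩

theorem IsSound.step_lift (hG : G.IsSound) (hM : M ∈ (G.box j).box.reach)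
    (hstep : (G.box j).box.Step M t L) : (G.net k).Step (G.lift M) t (G.lift L) := by
  obtain ⟨hfire, hmem⟩ := BoxExpr.step_box.1 hstep
  obtain ⟨ht, hpre⟩ := BoxExpr.fireable_box.1 hfire
  refine step_netOfPlaces.2 ⟨fireable_lift hfire, fun P => ⟨?_, ?_⟩⟩
  · rintro ⟨hP, Z, hZL, hZP⟩
    rcases (hmem Z).1 hZL with ⟨hZM, hnot⟩ | ⟨-, hinp⟩
    · refine .inl ⟨⟨hP, Z, hZM, hZP⟩, fun ⟨_, hout⟩ => ?_⟩
      obtain ⟨W, hW, houtW, hWP⟩ := exists_box_place_subset hP hout ht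
      obtain rfl := hG.eq_of_subset hM hP hZM (hpre W hW houtW) hZP hWP
      exact hnot ⟨hW, houtW⟩
    · exact .inr ⟨hP, hZP hinp⟩
  · rintro (⟨⟨hP, Z, hZM, hZP⟩, hnot⟩ | ⟨hP, hinp⟩)
    · exact ⟨hP, Z, (hmem Z).2 (.inl ⟨hZM, fun hout => hnot ⟨hP, hZP hout.2⟩⟩), hZP⟩
    · obtain ⟨Z, hZ, hinpZ, hZP⟩ := exists_box_place_subset hP hinp ht
      exact ⟨hP, Z, (hmem Z).2 (.inr ⟨hZ, hinpZ⟩), hZP⟩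

theorem IsSound.out_mem_of_inp_mem (hG : G.IsSound) (hM : M ∈ (G.box j).box.reach)
    (hfire : (G.box j).box.Fireable M t) (hP : P ∈ G.lift M) (hinp : Tagged.inp t ∈ P) :
    Tagged.out t ∈ P := by
  obtain ⟨hP, Z, hZM, hZP⟩ := hP
  obtain ⟨L, hstep⟩ : ∃ L, (G.box j).box.Step M t L := ⟨_, hfire, rfl⟩
  have hmem := (BoxExpr.step_box.1 hstep).2
  have ht := (BoxExpr.fireable_box.1 hfire).1
  obtain ⟨W, hW, hinpW, hWP⟩ := exists_box_place_subset hP hinp ht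
  by_contra hout
  have hZL : Z ∈ L := (hmem Z).2 (.inl ⟨hZM, fun h => hout (hZP h.2)⟩)
  have hWL : W ∈ L := (hmem W).2 (.inr ⟨hW, hinpW⟩)
  obtain rfl := hG.eq_of_subset (PetriNet.mem_reach_of_step hM hstep) hP hZL hWL hZP hWP
  exact hout (hZP (BoxExpr.safe_box.1 (hG.sound j).safe M hM t hfire Z hW hZM hinpW))

theorem mem_of_mem_lift_internal (hM : M ∈ (G.box j).box.reach) (hP : P ∈ (G.box i).internal)
    (hPM : P ∈ G.lift M) : P ∈ M := by
  obtain ⟨-, Z, hZM, hZP⟩ := hPM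
  exact eq_of_subset_of_mem_internal hP (BoxExpr.reach_box_subset hM hZM) hZP ▸ hZM

theorem fireable_of_fireable_lift (hM : M ∈ (G.box j).box.reach)
    (ht : t ∈ (G.box i).actions) (hfire : (G.net k).Fireable (G.lift M) t)
    (hentry : ∀ Z ∈ (G.box i).entry, Tagged.out t ∈ Z → Z ∈ M) :
    (G.box i).box.Fireable M t := by
  refine BoxExpr.fireable_box.2 ⟨ht, ?_⟩
  rintro Z ((hZ | hZ) | hZ) hout
  · exact hentry Z hZ hout
  · exact (BoxExpr.out_notMem_of_mem_exit hZ t hout).elim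
  · exact mem_of_mem_lift_internal hM hZ
      ((fireable_net.1 hfire).2 Z (internal_subset_places i hZ) hout)

/-- If every port at `node p` had an unmarked place, these places and `Z` would form a pre-place of
`t` that is not marked by `lift M`. -/
theorem exists_port_subset (hM : M ∈ (G.box j).box.reach)
    (hfire : (G.net k).Fireable (G.lift M) t) (hZ : Z ∈ G.port p) (hout : Tagged.out t ∈ Z)
    (hZM : Z ∉ M) : ∃ q, G.node q = G.node p ∧ G.port q ⊆ M := by
  classical
  by_contra! hne
  have unmarked (q : ι ⊕ ι) (hq : G.node q = G.node p) :
      ∃ W ∈ G.port q, W ∉ M ∧ (q = p → W = Z) := by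
    by_cases hqp : q = p
    · exact ⟨Z, hqp ▸ hZ, hZM, fun _ => rfl⟩
    · obtain ⟨W, hW, hWM⟩ := Set.not_subset.1 (hne q hq)
      exact ⟨W, hW, hWM, fun h => (hqp h).elim⟩
  choose! c hc hcM hcp using unmarked
  have hP : (⋃ q ∈ {q | G.node q = G.node p}, c q) ∈ G.junction (G.node p) := ⟨c, hc, rfl⟩
  have houtP : Tagged.out t ∈ ⋃ q ∈ {q | G.node q = G.node p}, c q :=
    Set.mem_biUnion rfl (hcp p rfl rfl ▸ hout)
  obtain ⟨-, W, hWM, hWP⟩ := (fireable_net.1 hfire).2 _ (junction_subset_places p hP) houtP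
  obtain ⟨q, -, hq, hW⟩ := exists_port_of_subset hP (BoxExpr.reach_box_subset hM hWM) hWP
  have hWc : W = c q :=
    eq_of_subset_of_mem_junction hP hW (hc q hq) hWP (Set.subset_biUnion_of_mem hq)
  exact hcM q hq (hWc ▸ hWM)

theorem IsSound.eq_port_of_port_subset (hG : G.IsSound) (hM : M ∈ (G.box j).box.reach)
    (hq : G.port q ⊆ M) : M = G.port q := by
  obtain ⟨Z, hZ⟩ := G.port_nonempty q
  have howner := owner_eq_of_mem hM (hq hZ) hZ
  rcases q with q | q <;> obtain rfl : q = j := howner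
  · exact BoxExpr.eq_entry_of_entry_subset hM hq
  · exact BoxExpr.eq_exit_of_exit_subset (hG.sound q) hM hq

/-- `M' ≠ M` occurs when `M` is the entry or exit marking of the box `j` and control passes at its
node to the box `i`; for a loop `i = j` is possible here. -/
theorem IsSound.exists_fireable (hG : G.IsSound) (hM : M ∈ (G.box j).box.reach)
    (ht : t ∈ (G.box i).actions) (hfire : (G.net k).Fireable (G.lift M) t) :
    ∃ M' ∈ (G.box i).box.reach, G.lift M' = G.lift M ∧ (G.box i).box.Fireable M' t := by
  by_cases hentry : ∀ Z ∈ (G.box i).entry, Tagged.out t ∈ Z → Z ∈ M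
  · have hfire' := fireable_of_fireable_lift hM ht hfire hentry
    obtain ⟨Z, hZ, hout⟩ := BoxExpr.exists_out_mem_places ht
    have hZM : Z ∈ M := (BoxExpr.fireable_box.1 hfire').2 Z hZ hout
    obtain rfl : i = j := eq_of_mem_places hZ (BoxExpr.reach_box_subset hM hZM) hout hout
    exact ⟨M, hM, rfl, hfire'⟩
  · push Not at hentry
    obtain ⟨Z, hZ, hout, hZM⟩ := hentry
    obtain ⟨q, hq, hqM⟩ := exists_port_subset (p := .inl i) hM hfire hZ hout hZM
    have hlift : G.lift (G.box i).entry = G.lift M := by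
      rw [hG.eq_port_of_port_subset hM hqM, lift_port, hq]
      exact lift_port (.inl i)
    have hi := (G.box i).box.init_mem_reach
    exact ⟨_, hi, hlift, fireable_of_fireable_lift hi ht (hlift ▸ hfire) fun _ hW _ => hW⟩

theorem IsSound.exists_eq_lift (hG : G.IsSound) (hj : G.src j = k) (hM : M ∈ (G.net k).reach) :
    ∃ i, ∃ L ∈ (G.box i).box.reach, M = G.lift L := by
  subst hj
  induction hM using PetriNet.reach_induction with
  | init => exact ⟨j, _, (G.box j).box.init_mem_reach, (lift_port (.inl j)).symm⟩
  | step M t M' hM hstep ih =>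
    obtain ⟨i, L, hL, rfl⟩ := ih
    obtain ⟨i', ht⟩ := (fireable_net.1 hstep.1).1
    obtain ⟨L₁, hL₁, hlift, hfire⟩ := hG.exists_fireable hL ht hstep.1
    have hstep₁ : (G.box i').box.Step L₁ t _ := ⟨hfire, rfl⟩
    rw [← hlift] at hstep
    exact ⟨i', _, PetriNet.mem_reach_of_step hL₁ hstep₁,
      hstep.2.trans (hG.step_lift (k := G.src j) hL₁ hstep₁).2.symm⟩

theorem IsSound.leads_lift (hG : G.IsSound) (hM : M ∈ (G.box j).box.reach) :
    (G.net k).Leads (G.lift M) (G.junction (G.tgt j)) := by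
  have hlift : G.lift (G.box j).exit = G.junction (G.tgt j) := lift_port (.inr j)
  rw [← hlift]
  induction (hG.sound j).leads_final M hM using Relation.ReflTransGen.head_induction_on with
  | refl => exact .refl
  | head hstep _ ih =>
    obtain ⟨t, hstep⟩ := hstep
    exact .head ⟨t, hG.step_lift hM hstep⟩ (ih (PetriNet.mem_reach_of_step hM hstep))

theorem IsSound.leads_junction (hG : G.IsSound) (j : ι) :
    (G.net k).Leads (G.junction (G.src j)) (G.junction (G.tgt j)) := by
  have hlift : G.lift (G.box j).entry = G.junction (G.src j) := lift_port (.inl j)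
  exact hlift ▸ hG.leads_lift (G.box j).box.init_mem_reach

theorem IsSound.mem_lift_of_mem_internal (hG : G.IsSound) (hM : M ∈ (G.box j).box.reach)
    (hP : P ∈ (G.box i).internal) (hsub : P ⊆ ⋃₀ G.lift M) : P ∈ G.lift M := by
  have hPM : P ⊆ ⋃₀ M := fun v hv => by
    obtain ⟨Q, hQ, hvQ⟩ := hsub hv
    exact ⟨Q, mem_of_mem_lift_internal hM (mem_internal_of_mem hQ.1 hvQ hP hv) hQ, hvQ⟩
  obtain ⟨v, hv⟩ := nonempty_of_mem_box (.inr hP)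
  obtain ⟨W, hWM, hvW⟩ := hPM hv
  obtain rfl : i = j := eq_of_mem_places (.inr hP) (BoxExpr.reach_box_subset hM hWM) hv hvW
  exact ⟨internal_subset_places i hP, P,
    (hG.sound i).mem_of_subset_sUnion M hM P (.inr hP) hPM, subset_rfl⟩

theorem exists_marked_port (hM : M ∈ (G.box j).box.reach) (hP : P ∈ G.junction k) (hvP : v ∈ P)
    (hQ : Q ∈ G.lift M) (hvQ : v ∈ Q) :
    ∃ p, owner p = j ∧ G.node p = k ∧ ∃ W ∈ G.port p, W ∈ M ∧ W ⊆ Q := by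
  obtain ⟨hQ, W, hWM, hWQ⟩ := hQ
  obtain ⟨r, rfl, Z, hZ, hvZ, -⟩ := exists_port_of_mem_junction hP hvP
  obtain ⟨hQr, -⟩ := mem_junction_of_mem hQ hvQ hZ hvZ
  obtain ⟨p, hp, hnode, hW⟩ := exists_port_of_subset hQr (BoxExpr.reach_box_subset hM hWM) hWQ
  exact ⟨p, hp, hnode, W, hW, hWM, hWQ⟩

theorem IsSound.mem_lift_of_mem_junction (hG : G.IsSound) (hM : M ∈ (G.box j).box.reach)
    (hP : P ∈ G.junction (G.node r)) (hsub : P ⊆ ⋃₀ G.lift M) : P ∈ G.lift M := by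
  obtain ⟨Z₀, hZ₀, hZ₀P⟩ := exists_mem_port_subset hP
  obtain ⟨v₀, hv₀⟩ := nonempty_of_mem_box (port_subset r hZ₀)
  obtain ⟨Q₀, hQ₀, hvQ₀⟩ := hsub (hZ₀P hv₀)
  obtain ⟨p, rfl, hnode, W₀, hW₀, hW₀M, -⟩ := exists_marked_port hM hP (hZ₀P hv₀) hQ₀ hvQ₀
  obtain ⟨Z, hZ, hZP⟩ := exists_mem_port_subset (hnode ▸ hP)
  have hZM : Z ⊆ ⋃₀ M := fun v hv => by
    obtain ⟨Q, hQ, hvQ⟩ := hsub (hZP hv)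
    obtain ⟨q, -, hq, W, hW, hWM, hWQ⟩ := exists_marked_port hM hP (hZP hv) hQ hvQ
    obtain rfl := hG.port_eq hM hW₀M hWM hW₀ hW (hnode.trans hq.symm)
    obtain ⟨hQp, Z', hZ', hvZ', hZ'Q⟩ := mem_junction_of_mem hQ.1 hvQ hZ hv
    obtain rfl := eq_of_subset_of_mem_junction hQp hZ' hW hZ'Q hWQ
    exact ⟨Z', hWM, hvZ'⟩
  exact ⟨junction_subset_places r hP, Z,
    (hG.sound _).mem_of_subset_sUnion M hM Z (port_subset p hZ) hZM, hZP⟩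

theorem IsSound.isSound_net {k' : κ} (hG : G.IsSound) (hj : G.src j = k)
    (hpath : ∀ i, Relation.ReflTransGen (fun a b => ∃ j, G.src j = a ∧ G.tgt j = b) (G.tgt i) k') :
    (G.net k).IsSound (G.junction k') where
  safe := by
    refine safe_netOfPlaces.2 fun M hM t hfire P _ hPM hinp => ?_
    obtain ⟨i, L, hL, rfl⟩ := hG.exists_eq_lift hj hM
    obtain ⟨i', ht⟩ := (fireable_net.1 hfire).1
    obtain ⟨L', hL', hlift, hfire'⟩ := hG.exists_fireable hL ht hfire
    exact hG.out_mem_of_inp_mem hL' hfire' (hlift ▸ hPM) hinp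
  leads_final M hM := by
    obtain ⟨i, L, hL, rfl⟩ := hG.exists_eq_lift hj hM
    refine (hG.leads_lift hL).trans ((hpath i).lift' G.junction ?_)
    rintro _ _ ⟨j, rfl, rfl⟩
    exact hG.leads_junction j
  mem_of_subset_sUnion M hM P hP hsub := by
    obtain ⟨i, L, hL, rfl⟩ := hG.exists_eq_lift hj hM
    rcases hP with hP | hP
    · obtain ⟨j, hP⟩ := Set.mem_iUnion.1 hP
      exact hG.mem_lift_of_mem_internal hL hP hsub
    · obtain ⟨r, hP⟩ := Set.mem_iUnion.1 hP
      exact hG.mem_lift_of_mem_junction hL hP hsub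

theorem IsSound.notMem_junction {k' : κ} (hG : G.IsSound) (hj : G.src j = k)
    (hsrc : ∀ i, G.src i ≠ k') (hex : ∀ i, G.src i = k → G.tgt i = k' → (G.box i).IsExclusive)
    (hM : M ∈ (G.net k).reach) (hP : P ∈ G.junction k) (hPM : P ∈ M) (hQ : Q ∈ G.junction k') :
    Q ∉ M := by
  intro hQM
  have hk : k ≠ k' := hj ▸ hsrc j
  obtain ⟨i, L, hL, rfl⟩ := hG.exists_eq_lift hj hM
  obtain ⟨-, Z, hZL, hZP⟩ := hPM
  obtain ⟨-, W, hWL, hWQ⟩ := hQM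
  obtain ⟨p, hp, hpk, hZ⟩ := exists_port_of_subset hP (BoxExpr.reach_box_subset hL hZL) hZP
  obtain ⟨q, hq, hqk, hW⟩ := exists_port_of_subset hQ (BoxExpr.reach_box_subset hL hWL) hWQ
  rcases p with p | p <;> rcases q with q | q <;> obtain rfl : p = i := hp <;>
    obtain rfl : q = p := hq
  · exact hk (hpk.symm.trans hqk)
  · exact hex q hpk hqk L hL Z hZ hZL W hW hWL
  · exact hsrc q hqk
  · exact hk (hpk.symm.trans hqk)

end BoxGraph

/-! ## Soundness of boxes -/

theorem crossProd_assoc {α : Type*} (Q R S : Set (Place α)) :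
    crossProd (crossProd Q R) S = crossProd Q (crossProd R S) :=
  Set.image2_assoc Set.union_assoc

theorem exists_fin_three {p : Fin 3 → Prop} : (∃ i, p i) ↔ p 0 ∨ p 1 ∨ p 2 := by
  rw [Fin.exists_fin_succ, Fin.exists_fin_two]
  rfl

namespace BoxGraph

variable {ι κ α : Type*} (G : BoxGraph ι κ α) {k : κ} {p q : ι ⊕ ι} {Z : Place α}

theorem junction_eq_port (h : ∀ r, G.node r = k ↔ r = p) : G.junction k = G.port p := by
  have hset : {r | G.node r = k} = {p} := Set.ext h
  rw [junction, hset, prodOver_singleton]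

theorem junction_eq_crossProd (h : ∀ r, G.node r = k ↔ r = p ∨ r = q) (hpq : p ≠ q) :
    G.junction k = crossProd (G.port p) (G.port q) := by
  have hset : {r | G.node r = k} = {p, q} := Set.ext h
  rw [junction, hset, prodOver_insert _ (by simpa using hpq), prodOver_singleton]

theorem mem_places : Z ∈ G.places ↔ (∃ j, Z ∈ (G.box j).internal) ∨
    (∃ j, Z ∈ G.junction (G.src j)) ∨ ∃ j, Z ∈ G.junction (G.tgt j) := by
  simp only [places, Set.mem_union, Set.mem_iUnion, Sum.exists]
  rfl

theorem net_eq_box {H : BoxExpr α} (hplaces : ∀ Z, Z ∈ G.places ↔ Z ∈ H.places)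
    (hactions : ∀ a, (∃ j, a ∈ (G.box j).actions) ↔ a ∈ H.actions)
    (hentry : G.junction k = H.entry) : G.net k = H.box := by
  rw [net, hentry, Set.ext hplaces, Set.ext hactions]
  rfl

end BoxGraph

namespace BoxExpr

variable {α : Type*} {E F G : BoxExpr α}

section Seq

/-- The graph `0 ⟶ 1 ⟶ 2` of the boxes `E` and `F`, from which `E; F` arises by gluing. -/
def seqGraph (h : (seq E F).actions.Nodup) : BoxGraph (Fin 2) (Fin 3) α where
  box := ![E, F]
  src := ![0, 1]
  tgt := ![1, 2]
  nodup := by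
    rw [actions, List.nodup_append'] at h
    exact Fin.forall_fin_two.2 ⟨h.1, h.2.1⟩
  disjoint i j hij := by
    have hEF := (List.nodup_append'.1 h).2.2
    fin_cases i <;> fin_cases j
    exacts [(hij rfl).elim, hEF, hEF.symm, (hij rfl).elim]

variable (h : (seq E F).actions.Nodup)

theorem junction_seqGraph_zero : (seqGraph h).junction 0 = E.entry :=
  BoxGraph.junction_eq_port (p := .inl 0) _ (by
    simp [BoxGraph.node, seqGraph, Fin.forall_fin_two])

theorem junction_seqGraph_one : (seqGraph h).junction 1 = crossProd E.exit F.entry :=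
  BoxGraph.junction_eq_crossProd (p := .inr 0) (q := .inl 1) _ (by
    simp [BoxGraph.node, seqGraph, Fin.forall_fin_two]) (by simp)

theorem junction_seqGraph_two : (seqGraph h).junction 2 = F.exit :=
  BoxGraph.junction_eq_port (p := .inr 1) _ (by
    simp [BoxGraph.node, seqGraph, Fin.forall_fin_two])

theorem net_seqGraph : (seqGraph h).net 0 = (seq E F).box := by
  refine BoxGraph.net_eq_box _ (fun Z => ?_) (fun a => ?_) (junction_seqGraph_zero h)
  · rw [BoxGraph.mem_places, Fin.exists_fin_two, Fin.exists_fin_two, Fin.exists_fin_two]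
    change (Z ∈ E.internal ∨ Z ∈ F.internal) ∨
      (Z ∈ (seqGraph h).junction 0 ∨ Z ∈ (seqGraph h).junction 1) ∨
      (Z ∈ (seqGraph h).junction 1 ∨ Z ∈ (seqGraph h).junction 2) ↔ _
    rw [junction_seqGraph_zero, junction_seqGraph_one, junction_seqGraph_two]
    simp only [places, entry, exit, internal, Set.mem_union]
    tauto
  · exact Fin.exists_fin_two.trans List.mem_append.symm

theorem isSound_seqGraph (hE : E.box.IsSound E.exit) (hF : F.box.IsSound F.exit) :
    (seqGraph h).IsSound where
  sound := Fin.forall_fin_two.2 ⟨hE, hF⟩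
  exclusive_of_loop := by simp [seqGraph, Fin.forall_fin_two]

theorem isSound_seq (h : (seq E F).actions.Nodup)
    (hE : E.box.IsSound E.exit) (hF : F.box.IsSound F.exit) :
    (seq E F).box.IsSound (seq E F).exit := by
  rw [← net_seqGraph h, exit, ← junction_seqGraph_two h]
  exact (isSound_seqGraph h hE hF).isSound_net (j := 0) rfl
    (Fin.forall_fin_two.2 ⟨.single ⟨1, rfl, rfl⟩, .refl⟩)

theorem isExclusive_seq (h : (seq E F).actions.Nodup)
    (hE : E.box.IsSound E.exit) (hF : F.box.IsSound F.exit) :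
    (seq E F).IsExclusive := by
  rw [IsExclusive, ← net_seqGraph h, entry, exit, ← junction_seqGraph_zero h,
    ← junction_seqGraph_two h]
  exact fun M hM Z hZ hZM W hW =>
    (isSound_seqGraph h hE hF).notMem_junction (j := 0) rfl
      (by simp [seqGraph, Fin.forall_fin_two]) (by simp [seqGraph, Fin.forall_fin_two])
      hM hZ hZM hW

end Seq

section Choice

/-- The graph with two arcs `0 ⟶ 1` for the boxes `E` and `F`, from which `E □ F` arises by
gluing. -/
def choiceGraph (h : (choice E F).actions.Nodup) : BoxGraph (Fin 2) (Fin 2) α where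
  box := ![E, F]
  src := ![0, 0]
  tgt := ![1, 1]
  nodup := by
    rw [actions, List.nodup_append'] at h
    exact Fin.forall_fin_two.2 ⟨h.1, h.2.1⟩
  disjoint i j hij := by
    have hEF := (List.nodup_append'.1 h).2.2
    fin_cases i <;> fin_cases j
    exacts [(hij rfl).elim, hEF, hEF.symm, (hij rfl).elim]

variable (h : (choice E F).actions.Nodup)

theorem junction_choiceGraph_zero : (choiceGraph h).junction 0 = crossProd E.entry F.entry :=
  BoxGraph.junction_eq_crossProd (p := .inl 0) (q := .inl 1) _ (by
    simp [BoxGraph.node, choiceGraph, Fin.forall_fin_two]) (by simp)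

theorem junction_choiceGraph_one : (choiceGraph h).junction 1 = crossProd E.exit F.exit :=
  BoxGraph.junction_eq_crossProd (p := .inr 0) (q := .inr 1) _ (by
    simp [BoxGraph.node, choiceGraph, Fin.forall_fin_two]) (by simp)

theorem net_choiceGraph : (choiceGraph h).net 0 = (choice E F).box := by
  refine BoxGraph.net_eq_box _ (fun Z => ?_) (fun a => ?_) (junction_choiceGraph_zero h)
  · rw [BoxGraph.mem_places, Fin.exists_fin_two, Fin.exists_fin_two, Fin.exists_fin_two]
    change (Z ∈ E.internal ∨ Z ∈ F.internal) ∨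
      (Z ∈ (choiceGraph h).junction 0 ∨ Z ∈ (choiceGraph h).junction 0) ∨
      (Z ∈ (choiceGraph h).junction 1 ∨ Z ∈ (choiceGraph h).junction 1) ↔ _
    rw [junction_choiceGraph_zero, junction_choiceGraph_one]
    simp only [places, entry, exit, internal, Set.mem_union]
    tauto
  · exact Fin.exists_fin_two.trans List.mem_append.symm

theorem isSound_choiceGraph (hE : E.box.IsSound E.exit) (hF : F.box.IsSound F.exit) :
    (choiceGraph h).IsSound where
  sound := Fin.forall_fin_two.2 ⟨hE, hF⟩
  exclusive_of_loop := by simp [choiceGraph, Fin.forall_fin_two]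

theorem isSound_choice (h : (choice E F).actions.Nodup)
    (hE : E.box.IsSound E.exit) (hF : F.box.IsSound F.exit) :
    (choice E F).box.IsSound (choice E F).exit := by
  rw [← net_choiceGraph h, exit, ← junction_choiceGraph_one h]
  exact (isSound_choiceGraph h hE hF).isSound_net (j := 0) rfl (Fin.forall_fin_two.2 ⟨.refl, .refl⟩)

theorem isExclusive_choice (h : (choice E F).actions.Nodup) (hE : E.box.IsSound E.exit)
    (hF : F.box.IsSound F.exit) (hE' : E.IsExclusive) (hF' : F.IsExclusive) :
    (choice E F).IsExclusive := by
  rw [IsExclusive, ← net_choiceGraph h, entry, exit, ← junction_choiceGraph_zero h,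
    ← junction_choiceGraph_one h]
  exact fun M hM Z hZ hZM W hW =>
    (isSound_choiceGraph h hE hF).notMem_junction (j := 0) rfl
      (by simp [choiceGraph, Fin.forall_fin_two])
      (Fin.forall_fin_two.2 ⟨fun _ _ => hE', fun _ _ => hF'⟩) hM hZ hZM hW

end Choice

section Iter

/-- The graph with arcs `0 ⟶ 1`, `1 ⟶ 1` and `1 ⟶ 2` for the boxes `E`, `F` and `G`, from which
`⟨E * F * G⟩` arises by gluing. -/
def iterGraph (h : (iter E F G).actions.Nodup) : BoxGraph (Fin 3) (Fin 3) α where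
  box := ![E, F, G]
  src := ![0, 1, 1]
  tgt := ![1, 1, 2]
  nodup := by
    rw [actions, List.nodup_append', List.nodup_append'] at h
    exact Fin.forall_fin_succ.2 ⟨h.1.1, Fin.forall_fin_two.2 ⟨h.1.2.1, h.2.1⟩⟩
  disjoint i j hij := by
    rw [actions, List.nodup_append', List.nodup_append', List.disjoint_append_left] at h
    obtain ⟨⟨-, -, hEF⟩, -, hEG, hFG⟩ := h
    fin_cases i <;> fin_cases j
    exacts [(hij rfl).elim, hEF, hEG, hEF.symm, (hij rfl).elim, hFG, hEG.symm, hFG.symm,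
      (hij rfl).elim]

variable (h : (iter E F G).actions.Nodup)

theorem junction_iterGraph_zero : (iterGraph h).junction 0 = E.entry :=
  BoxGraph.junction_eq_port (p := .inl 0) _ (by
    simp [BoxGraph.node, iterGraph, Fin.forall_fin_succ])

theorem junction_iterGraph_one : (iterGraph h).junction 1 =
    crossProd (crossProd E.exit F.exit) (crossProd G.entry F.entry) := by
  have hset : {p | (iterGraph h).node p = 1} = {.inr 0, .inr 1, .inl 2, .inl 1} := by
    ext (j | j) <;> fin_cases j <;> simp [BoxGraph.node, iterGraph]
  rw [BoxGraph.junction, hset, prodOver_insert _ (by simp), prodOver_insert _ (by simp),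
    prodOver_insert _ (by simp), prodOver_singleton, crossProd_assoc]
  rfl

theorem junction_iterGraph_two : (iterGraph h).junction 2 = G.exit :=
  BoxGraph.junction_eq_port (p := .inr 2) _ (by
    simp [BoxGraph.node, iterGraph, Fin.forall_fin_succ])

theorem net_iterGraph : (iterGraph h).net 0 = (iter E F G).box := by
  refine BoxGraph.net_eq_box _ (fun Z => ?_) (fun a => ?_) (junction_iterGraph_zero h)
  · rw [BoxGraph.mem_places, exists_fin_three, exists_fin_three, exists_fin_three]
    change (Z ∈ E.internal ∨ Z ∈ F.internal ∨ Z ∈ G.internal) ∨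
      (Z ∈ (iterGraph h).junction 0 ∨ Z ∈ (iterGraph h).junction 1 ∨
        Z ∈ (iterGraph h).junction 1) ∨
      (Z ∈ (iterGraph h).junction 1 ∨ Z ∈ (iterGraph h).junction 1 ∨
        Z ∈ (iterGraph h).junction 2) ↔ _
    rw [junction_iterGraph_zero, junction_iterGraph_one, junction_iterGraph_two]
    simp only [places, entry, exit, internal, Set.mem_union]
    tauto
  · rw [actions, List.mem_append, List.mem_append, or_assoc]
    exact exists_fin_three

theorem isSound_iterGraph (hE : E.box.IsSound E.exit) (hF : F.box.IsSound F.exit)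
    (hF' : F.IsExclusive) (hG : G.box.IsSound G.exit) : (iterGraph h).IsSound where
  sound := Fin.forall_fin_succ.2 ⟨hE, Fin.forall_fin_two.2 ⟨hF, hG⟩⟩
  exclusive_of_loop := by simpa [iterGraph, Fin.forall_fin_succ] using hF'

theorem isSound_iter (h : (iter E F G).actions.Nodup) (hE : E.box.IsSound E.exit)
    (hF : F.box.IsSound F.exit) (hF' : F.IsExclusive) (hG : G.box.IsSound G.exit) :
    (iter E F G).box.IsSound (iter E F G).exit := by
  rw [← net_iterGraph h, exit, ← junction_iterGraph_two h]
  exact (isSound_iterGraph h hE hF hF' hG).isSound_net (j := 0) rfl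
    (Fin.forall_fin_succ.2 ⟨.single ⟨2, rfl, rfl⟩,
      Fin.forall_fin_two.2 ⟨.single ⟨2, rfl, rfl⟩, .refl⟩⟩)

theorem isExclusive_iter (h : (iter E F G).actions.Nodup) (hE : E.box.IsSound E.exit)
    (hF : F.box.IsSound F.exit) (hF' : F.IsExclusive) (hG : G.box.IsSound G.exit) :
    (iter E F G).IsExclusive := by
  rw [IsExclusive, ← net_iterGraph h, entry, exit, ← junction_iterGraph_zero h,
    ← junction_iterGraph_two h]
  exact fun M hM Z hZ hZM W hW =>
    (isSound_iterGraph h hE hF hF' hG).notMem_junction (j := 0) rfl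
      (by simp [iterGraph, Fin.forall_fin_succ]) (by simp [iterGraph, Fin.forall_fin_succ])
      hM hZ hZM hW

end Iter

theorem isSound_of_derives {n : NonTerm} (hE : Derives n E) (h : E.actions.Nodup) :
    E.box.IsSound E.exit ∧ (n = .H → E.IsExclusive) := by
  induction hE with
  | actE a | actH a => exact ⟨isSound_act a, fun _ => isExclusive_act a⟩
  | seqE _ _ ihE ihF | seqH _ _ ihE ihF =>
    obtain ⟨hE, hF, -⟩ := List.nodup_append'.1 h
    have hE := (ihE hE).1
    have hF := (ihF hF).1
    exact ⟨isSound_seq h hE hF, fun _ => isExclusive_seq h hE hF⟩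
  | choiceE _ _ ihE ihF =>
    obtain ⟨hE, hF, -⟩ := List.nodup_append'.1 h
    exact ⟨isSound_choice h (ihE hE).1 (ihF hF).1, nofun⟩
  | choiceH _ _ ihE ihF =>
    obtain ⟨hE, hF, -⟩ := List.nodup_append'.1 h
    obtain ⟨hE, hE'⟩ := ihE hE
    obtain ⟨hF, hF'⟩ := ihF hF
    exact ⟨isSound_choice h hE hF, fun _ => isExclusive_choice h hE hF (hE' rfl) (hF' rfl)⟩
  | parE _ _ ihE ihF =>
    obtain ⟨hE, hF, hEF⟩ := List.nodup_append'.1 h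
    exact ⟨isSound_par hEF (ihE hE).1 (ihF hF).1, nofun⟩
  | iterE _ _ _ ihE ihF ihG | iterH _ _ _ ihE ihF ihG =>
    obtain ⟨hEF, hG, -⟩ := List.nodup_append'.1 h
    obtain ⟨hE, hF, -⟩ := List.nodup_append'.1 hEF
    have hE := (ihE hE).1
    have hG := (ihG hG).1
    obtain ⟨hF, hF'⟩ := ihF hF
    exact ⟨isSound_iter h hE hF (hF' rfl) hG, fun _ => isExclusive_iter h hE hF (hF' rfl) hG⟩

end BoxExpr

/-! ## Nets of clique covers -/

namespace ConnGraph

variable {α : Type*} {G : ConnGraph α} {C : Set (Set (Tagged α))}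

theorem IsEdgeCliqueCover.isPartialEdgeCliqueCover (hC : G.IsEdgeCliqueCover C)
    (D : Tagged α → Tagged α → Prop) : G.IsPartialEdgeCliqueCover D C where
  subset_maxCliques := hC.subset_maxCliques
  covers_edge v w hvw _ := hC.covers_edge v w hvw id
  covers_isolated := hC.covers_isolated

theorem IsPartialEdgeCliqueCover.coversOutputs (hC : G.IsPartialEdgeCliqueCover InIn C) :
    CoversOutputs G.maxCliques C := by
  have covers_edge_out (t : α) (v : Tagged α) (h : G.Adj (.out t) v) :
      ∃ K ∈ C, .out t ∈ K ∧ v ∈ K :=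
    hC.covers_edge _ _ h fun hin => nomatch hin.1
  intro Z hZ t hout v hv
  rcases eq_or_ne v (.out t) with rfl | hne
  · by_cases hiso : ∃ w, G.Adj (.out t) w
    · obtain ⟨w, hw⟩ := hiso
      obtain ⟨K, hK, htK, -⟩ := covers_edge_out t w hw
      exact ⟨K, hK, htK, htK⟩
    · obtain ⟨K, hK, htK⟩ :=
        hC.covers_isolated _ (hZ.prop.2.1 hout) fun w hw => hiso ⟨w, hw⟩
      exact ⟨K, hK, htK, htK⟩
  · exact covers_edge_out t v (hZ.prop.2.2 hout hv hne.symm)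

end ConnGraph

theorem deleteSinks_netOfPlaces {α : Type*} (P : Set (Place α)) (T : Set α) (I : Set (Place α)) :
    (netOfPlaces P T I).deleteSinks =
      netOfPlaces {Z ∈ P | ∃ t ∈ T, Tagged.out t ∈ Z} T
        (I ∩ {Z ∈ P | ∃ t ∈ T, Tagged.out t ∈ Z}) := by
  have outputs_nonempty (Z : Place α) :
      ((netOfPlaces P T I).outputs Z).Nonempty ↔ Z ∈ P ∧ ∃ t ∈ T, Tagged.out t ∈ Z :=
    exists_and_left
  simp only [PetriNet.deleteSinks, outputs_nonempty]
  simp only [netOfPlaces, PetriNet.mk.injEq, Set.ext_iff, funext_iff, Set.mem_inter_iff,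
    Set.mem_ofPred_eq, eq_iff_iff]
  grind

/-- `N` is a safe marked net whose reachability graph is isomorphic to that of `N'`. -/
def PetriNet.SafelyImplements {π π' τ : Type*} (N : PetriNet π τ) (N' : PetriNet π' τ) : Prop :=
  N.IsMarkedNet ∧ N.Safe ∧ N.RGIso N'

namespace BoxExpr

variable {α : Type*} {E : BoxExpr α} {C : Set (Place α)} {t : α}

theorem exists_out_mem_of_coversOutputs (hcov : CoversOutputs E.places C) (ht : t ∈ E.actions) :
    ∃ Z ∈ C, Tagged.out t ∈ Z := by
  obtain ⟨Z, hZ, hout⟩ := exists_out_mem_places ht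
  obtain ⟨K, hK, htK, -⟩ := hcov Z hZ t hout _ hout
  exact ⟨K, hK, htK⟩

theorem cliqueNet_eq (hC : C ⊆ E.places) (hcov : CoversOutputs E.places C) :
    cliqueNet C = netOfPlaces C {a | a ∈ E.actions} (E.entry ∩ C) := by
  have htrans : {t | ∃ Z ∈ C, Tagged.inp t ∈ Z} ∪ {t | ∃ Z ∈ C, Tagged.out t ∈ Z} =
      {a | a ∈ E.actions} := by
    ext t
    refine ⟨?_, fun ht => .inr (exists_out_mem_of_coversOutputs hcov ht)⟩
    rintro (⟨Z, hZ, hv⟩ | ⟨Z, hZ, hv⟩)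
    · exact action_mem (hC hZ) hv
    · exact action_mem (hC hZ) hv
  have hinit : {Z ∈ C | ∀ t, Tagged.inp t ∉ Z} = E.entry ∩ C := by
    ext Z
    refine ⟨fun ⟨hZ, hinp⟩ => ?_, fun ⟨hentry, hZ⟩ => ⟨hZ, inp_notMem_of_mem_entry hentry⟩⟩
    rcases hC hZ with (hentry | hexit) | hint
    · exact ⟨hentry, hZ⟩
    · obtain ⟨a, ha⟩ := exists_inp_mem_of_mem_exit hexit
      exact (hinp a ha).elim
    · obtain ⟨a, ha⟩ := exists_inp_mem_of_mem_internal hint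
      exact (hinp a ha).elim
  rw [cliqueNet, htrans, hinit]

theorem safelyImplements_box_of_coversOutputs (h : E.actions.Nodup) (hE : E.box.IsSound E.exit)
    (hC : C ⊆ E.places) (hcov : CoversOutputs E.places C) :
    (netOfPlaces C {a | a ∈ E.actions} (E.entry ∩ C)).SafelyImplements E.box := by
  refine ⟨isMarkedNet_netOfPlaces (E.finite_places.subset hC) E.actions.finite_toSet
    Set.inter_subset_right (fun Z hZ => ?_) fun t => exists_out_mem_of_coversOutputs hcov,
    safe_inter hC hcov hE, rgIso_inter hC hcov (fun t => exists_out_mem_places)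
      (fun Z => out_notMem_of_mem_exit) hE⟩
  obtain ⟨v, hv⟩ := nonempty_of_mem_places h (hC hZ)
  exact ⟨v, hv, action_mem (hC hZ) hv⟩

theorem safelyImplements_cliqueNet (h : E.actions.Nodup) (hE : E.box.IsSound E.exit)
    (hC : E.connGraph.IsPartialEdgeCliqueCover ConnGraph.InIn C) :
    (cliqueNet C).SafelyImplements E.box ∧ (cliqueNet C).deleteSinks.SafelyImplements E.box := by
  have hsub : C ⊆ E.places := maxCliques_connGraph h ▸ hC.subset_maxCliques
  have hcov : CoversOutputs E.places C := maxCliques_connGraph h ▸ hC.coversOutputs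
  rw [cliqueNet_eq hsub hcov, deleteSinks_netOfPlaces, Set.inter_assoc,
    Set.inter_eq_right.2 (Set.sep_subset _ _)]
  refine ⟨safelyImplements_box_of_coversOutputs h hE hsub hcov,
    safelyImplements_box_of_coversOutputs h hE ((Set.sep_subset _ _).trans hsub)
      fun Z hZ t hout v hv => ?_⟩
  obtain ⟨K, hK, htK, hvK⟩ := hcov Z hZ t hout v hv
  exact ⟨K, ⟨hK, t, action_mem hZ hout, htK⟩, htK, hvK⟩

end BoxExpr

theorem theorem6p1 {α : Type*} (E : BoxExpr α) (hE : Derives NonTerm.E E)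
    (hnodup : E.actions.Nodup) :
    (∀ C : Set (Set (Tagged α)), E.connGraph.IsEdgeCliqueCover C →
      ((cliqueNet C).IsMarkedNet ∧ (cliqueNet C).Safe ∧ (cliqueNet C).RGIso E.box) ∧
      ((cliqueNet C).deleteSinks.IsMarkedNet ∧ (cliqueNet C).deleteSinks.Safe ∧
        (cliqueNet C).deleteSinks.RGIso E.box)) ∧
    (∀ C : Set (Set (Tagged α)), E.connGraph.IsPartialEdgeCliqueCover ConnGraph.InIn C →
      ((cliqueNet C).IsMarkedNet ∧ (cliqueNet C).Safe ∧ (cliqueNet C).RGIso E.box) ∧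
      ((cliqueNet C).deleteSinks.IsMarkedNet ∧ (cliqueNet C).deleteSinks.Safe ∧
        (cliqueNet C).deleteSinks.RGIso E.box)) := by
  have hbox := (BoxExpr.isSound_of_derives hE hnodup).1
  have hpartial {C : Set (Set (Tagged α))} :=
    BoxExpr.safelyImplements_cliqueNet (C := C) hnodup hbox
  exact ⟨fun C hC => hpartial (hC.isPartialEdgeCliqueCover ConnGraph.InIn), fun C => hpartial⟩
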